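/- Let $T>0$, $A\in\mathbb R^{n\times n}$, $G\in\mathbb R^{n\times n^2}$, $F\in\mathbb R^{n\times m}$, $C\in\mathbb R^{r\times n}$, $x_0\in\mathbb R^n$ and $\alpha>0$. For $t\in(0,T]$ let $V_t=H^1(0,t;\mathbb R^n)$ with the norm $\max(\|x\|_{H^1(0,t;\mathbb R^n)},\|x\|_{L^\infty(0,t;\mathbb R^n)})$, point values being those of the continuous representative. Assume that $\tilde x\in V_T$ solves $\dot{\tilde x}=A\tilde x+G(\tilde x\otimes\tilde x)$ almost everywhere in $[0,T]$ with $\tilde x(0)=x_0$. For $t\in(0,T]$, $\xi\in\mathbb R^n$ and $\omega\in L^2(0,t;\mathbb R^r)$ consider the optimal control problem of minimizing $$J(x,v;t,\omega)=\tfrac12\|x(0)-x_0\|^2+\tfrac12\int_0^t\|v(s)\|^2+\alpha\|\omega(s)-C(x(s)-\tilde x(s))\|^2\,\mathrm ds$$ over all $(x,v)\in V_t\times L^2(0,t;\mathbb R^m)$ such that $\dot x=Ax+G(x\otimes x)+Fv$ almost everywhere in $[0,t]$ and $x(t)=\tilde x(t)+\xi$. Let $\mathcal V(t,\xi,\omega)$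 denote the infimum. For $\omega\in L^2(0,T;\mathbb R^r)$ write $\mathcal V(t,\xi,\omega)=\mathcal V(t,\xi,\omega|_{(0,t)})$. Products of normed spaces carry the maximum norm, and $\mathcal U_\delta(0)$ is the open ball of radius $\delta$ around $0$. Then there is a constant $\delta_4>0$, independent of $t$, such that for every $t\in(0,T]$ the following hold. 1. The function $\mathcal V(t,\cdot,\cdot)$ is of class $C^\infty$ (in the Fréchet sense) on $\mathcal U_{\delta_4}(0)\subset\mathbb R^n\times L^2(0,t;\mathbb R^r)$, and likewise on $\mathcal U_{\delta_4}(0)\subset\mathbb R^n\times L^2(0,T;\mathbb R^r)$. 2. For every $(\xi,\omega)\in\mathcal U_{\delta_4}(0)\subset\mathbb R^n\times L^2(0,t;\mathbb R^r)$ the optimal control problem has exactly one solution $(\bar x,\bar v)$ (a global minimizer), and the map $(\xi,\omega)\mapsto(\bar x,\bar v)\in V_t\times L^2(0,t;\mathbb R^m)$ is of class $C^\infty$ on $\mathcal U_{\delta_4}(0)$. -/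

import Mathlib

open MeasureTheory Set Metric
open scoped ContDiff

noncomputable section

namespace MinEnergy

/-- The Euclidean space `ℝ^d`. -/
abbrev E (d : ℕ) : Type := EuclideanSpace ℝ (Fin d)

/-- The Lebesgue space `L²(0,t;ℝ^d)`. -/
abbrev L2 (t : ℝ) (d : ℕ) : Type := Lp (E d) 2 (volume.restrict (Ioc (0 : ℝ) t))

/-- `g` is a weak derivative of `f` on the interval `(0,t)`. -/
def HasWeakDeriv {d : ℕ} (t : ℝ) (f g : ℝ → E d) : Prop :=
  ∀ φ : ℝ → ℝ, ContDiff ℝ ∞ φ → HasCompactSupport φ → tsupport φ ⊆ Ioo (0 : ℝ) t →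
    ∫ s in Ioc (0 : ℝ) t, deriv φ s • f s = - ∫ s in Ioc (0 : ℝ) t, φ s • g s

lemma integrable_smul_L2 {d : ℕ} {t : ℝ} {ψ : ℝ → ℝ} (hψ : Continuous ψ)
    (hc : HasCompactSupport ψ) (f : L2 t d) :
    Integrable (fun s => ψ s • f s) (volume.restrict (Ioc (0 : ℝ) t)) := by
  obtain ⟨K, hK⟩ := hc.exists_bound_of_continuous hψ
  have hf : Integrable (f : ℝ → E d) (volume.restrict (Ioc (0 : ℝ) t)) :=
    (Lp.memLp f).integrable (by norm_num)
  exact hf.bdd_smul K hψ.aestronglyMeasurable (Filter.Eventually.of_forall hK)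

lemma hasWeakDeriv_zero {d : ℕ} {t : ℝ} :
    HasWeakDeriv t (((0 : L2 t d) : L2 t d) : ℝ → E d) ((0 : L2 t d) : ℝ → E d) := by
  intro φ _ _ _
  have h0 := Lp.coeFn_zero (E d) 2 (volume.restrict (Ioc (0 : ℝ) t))
  have h1 : ∫ s in Ioc (0 : ℝ) t, deriv φ s • (0 : L2 t d) s = 0 := by
    refine integral_eq_zero_of_ae ?_
    filter_upwards [h0] with s hs
    rw [hs]
    exact smul_zero _
  have h2 : ∫ s in Ioc (0 : ℝ) t, φ s • (0 : L2 t d) s = 0 := by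
    refine integral_eq_zero_of_ae ?_
    filter_upwards [h0] with s hs
    rw [hs]
    exact smul_zero _
  rw [h1, h2, neg_zero]

lemma HasWeakDeriv.add {d : ℕ} {t : ℝ} {f g f' g' : L2 t d}
    (h : HasWeakDeriv t f g) (h' : HasWeakDeriv t f' g') :
    HasWeakDeriv t ((f + f' : L2 t d) : ℝ → E d) ((g + g' : L2 t d) : ℝ → E d) := by
  intro φ hφ hc hs
  have key : ∀ (ψ : ℝ → ℝ), Continuous ψ → HasCompactSupport ψ → ∀ a b : L2 t d,
      ∫ s in Ioc (0 : ℝ) t, ψ s • (a + b : L2 t d) s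
        = (∫ s in Ioc (0 : ℝ) t, ψ s • a s) + ∫ s in Ioc (0 : ℝ) t, ψ s • b s := by
    intro ψ hψ hψc a b
    rw [← integral_add (integrable_smul_L2 hψ hψc a) (integrable_smul_L2 hψ hψc b)]
    refine integral_congr_ae ?_
    filter_upwards [Lp.coeFn_add a b] with s hs
    rw [hs]
    exact smul_add _ _ _
  rw [key _ (hφ.continuous_deriv (by simp)) hc.deriv, key _ hφ.continuous hc,
    h φ hφ hc hs, h' φ hφ hc hs, neg_add]

lemma HasWeakDeriv.smul {d : ℕ} {t : ℝ} {f g : L2 t d} (c : ℝ)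
    (h : HasWeakDeriv t f g) :
    HasWeakDeriv t ((c • f : L2 t d) : ℝ → E d) ((c • g : L2 t d) : ℝ → E d) := by
  intro φ hφ hc hs
  have key : ∀ (ψ : ℝ → ℝ) (a : L2 t d),
      ∫ s in Ioc (0 : ℝ) t, ψ s • (c • a : L2 t d) s
        = c • ∫ s in Ioc (0 : ℝ) t, ψ s • a s := by
    intro ψ a
    rw [← integral_smul]
    refine integral_congr_ae ?_
    filter_upwards [Lp.coeFn_smul c a] with s hs
    rw [hs]
    exact smul_comm (ψ s) c (a s)
  rw [key, key, h φ hφ hc hs, smul_neg]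

/-- The space `V_t = H¹(0,t;ℝ^d)` with the norm `max (‖x‖_{H¹}) (‖x‖_{L^∞})`.
An element consists of the function and its weak derivative, both in `L²(0,t;ℝ^d)`, together
with the continuous representative of the function on `[0,t]`. The first two carry the Euclidean
product norm, i.e. the `H¹` norm; the third carries the sup norm; the outer product carries the
maximum of the two norms. -/
def V (t : ℝ) (d : ℕ) : Submodule ℝ (WithLp 2 (L2 t d × L2 t d) × C(Icc (0 : ℝ) t, E d)) where
  carrier := {q |
    (∀ᵐ s ∂(volume.restrict (Ioc (0 : ℝ) t)), ∀ hs : s ∈ Icc (0 : ℝ) t,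
      q.1.fst s = q.2 ⟨s, hs⟩) ∧
    HasWeakDeriv t q.1.fst q.1.snd}
  add_mem' := by
    rintro a b ⟨ha, ha'⟩ ⟨hb, hb'⟩
    refine ⟨?_, ha'.add hb'⟩
    filter_upwards [ha, hb, Lp.coeFn_add a.1.fst b.1.fst] with s h1 h2 h3 hs
    have : ((a + b).1.fst : L2 t d) s = a.1.fst s + b.1.fst s := h3
    rw [this, h1 hs, h2 hs]
    rfl
  zero_mem' := by
    refine ⟨?_, hasWeakDeriv_zero⟩
    filter_upwards [Lp.coeFn_zero (E d) 2 (volume.restrict (Ioc (0 : ℝ) t))] with s h hs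
    exact h
  smul_mem' := by
    rintro c a ⟨ha, ha'⟩
    refine ⟨?_, ha'.smul c⟩
    filter_upwards [ha, Lp.coeFn_smul c a.1.fst] with s h1 h3 hs
    have : ((c • a).1.fst : L2 t d) s = c • a.1.fst s := h3
    rw [this, h1 hs]
    rfl

open Classical in
/-- The value `x(s)` of (the continuous representative of) `x ∈ V_t` at `s ∈ [0,t]`
(and `0` outside of `[0,t]`). -/
def V.val {t : ℝ} {d : ℕ} (x : V t d) (s : ℝ) : E d :=
  if hs : s ∈ Icc (0 : ℝ) t then x.1.2 ⟨s, hs⟩ else 0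

/-- The weak derivative `ẋ ∈ L²(0,t;ℝ^d)` of `x ∈ V_t`. -/
def V.dot {t : ℝ} {d : ℕ} (x : V t d) : L2 t d := x.1.1.snd

/-- The Kronecker product `x ⊗ y` of two vectors, indexed by pairs. -/
def kron {n : ℕ} (x y : E n) : EuclideanSpace ℝ (Fin n × Fin n) :=
  WithLp.toLp 2 fun p => x p.1 * y p.2

/-- The data of the problem: the matrices `A ∈ ℝ^{n×n}`, `G ∈ ℝ^{n×n²}`, `F ∈ ℝ^{n×m}`,
`C ∈ ℝ^{r×n}`, the initial value `x₀ ∈ ℝ^n` and the weight `α`. -/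
structure Data (n m r : ℕ) where
  A : Matrix (Fin n) (Fin n) ℝ
  G : Matrix (Fin n) (Fin n × Fin n) ℝ
  F : Matrix (Fin n) (Fin m) ℝ
  C : Matrix (Fin r) (Fin n) ℝ
  x₀ : E n
  α : ℝ

variable {n m r : ℕ}

/-- `xt ∈ V_T` solves `ẋ = A x + G (x ⊗ x)` almost everywhere in `[0,T]`, with `x(0) = x₀`. -/
def IsNominal (D : Data n m r) (T : ℝ) (xt : V T n) : Prop :=
  (∀ᵐ s ∂(volume.restrict (Ioc (0 : ℝ) T)),
    V.dot xt s = D.A.toEuclideanLin (V.val xt s)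
      + D.G.toEuclideanLin (kron (V.val xt s) (V.val xt s))) ∧
  V.val xt 0 = D.x₀

/-- The cost `J(x,v;t,w) = ½‖x(0) - x₀‖² + ½ ∫₀ᵗ ‖v‖² + α ‖w - C(x - x̃)‖² ds`. -/
def J (D : Data n m r) {T : ℝ} (xt : V T n) (t : ℝ) (w : ℝ → E r)
    (q : V t n × L2 t m) : ℝ :=
  (1 / 2) * ‖V.val q.1 0 - D.x₀‖ ^ 2
    + (1 / 2) * ∫ s in (0 : ℝ)..t, (‖q.2 s‖ ^ 2
        + D.α * ‖w s - D.C.toEuclideanLin (V.val q.1 s - V.val xt s)‖ ^ 2)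

/-- The pairs `(x,v) ∈ V_t × L²(0,t;ℝ^m)` with `e(x,v;t,ξ) = 0`, i.e.
`ẋ = A x + G (x ⊗ x) + F v` almost everywhere in `[0,t]` and `x(t) = x̃(t) + ξ`. -/
def feasible (D : Data n m r) {T : ℝ} (xt : V T n) (t : ℝ) (ξ : E n) :
    Set (V t n × L2 t m) :=
  {q | (∀ᵐ s ∂(volume.restrict (Ioc (0 : ℝ) t)),
      V.dot q.1 s = D.A.toEuclideanLin (V.val q.1 s)
        + D.G.toEuclideanLin (kron (V.val q.1 s) (V.val q.1 s))
        + D.F.toEuclideanLin (q.2 s)) ∧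
    V.val q.1 t = V.val xt t + ξ}

/-- `q = (x,v)` is a (global) solution of the optimal control problem for `(t,ξ,w)`. -/
def IsSolution (D : Data n m r) {T : ℝ} (xt : V T n) (t : ℝ) (ξ : E n) (w : ℝ → E r)
    (q : V t n × L2 t m) : Prop :=
  q ∈ feasible D xt t ξ ∧ ∀ q' ∈ feasible D xt t ξ, J D xt t w q ≤ J D xt t w q'

/-- The value function `𝒱(t,ξ,w)`, for `t > 0`. -/
def value (D : Data n m r) {T : ℝ} (xt : V T n) (t : ℝ) (ξ : E n) (w : ℝ → E r) : ℝ :=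
  sInf (J D xt t w '' feasible D xt t ξ)

end MinEnergy

end

noncomputable section

namespace MinEnergy

/-! ### Quadratic equations `y = η + B(y, y)` in a Banach space -/

section QuadraticFixedPoint

variable {X : Type*} [NormedAddCommGroup X] [NormedSpace ℝ X]

/-! The control problem is reduced to an unconstrained, smooth, strongly convex minimization over
small controls. Because the vector field is quadratic, its expansion around the nominal trajectory
is exact: the deviation `y = x - x̃` on `[0,t]` satisfies `y = R(ξ, v) + B(y, y)` with `R` bounded
linear and `B` bounded bilinear. These come from inverting the linearized equation, a Volterra
equation integrated backwards from the terminal time (`ctrl_eq_iff`). All norms are bounded in terms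
of `T`, the data and the sup norm of `x̃`, which makes the final radius independent of `t`.

For small `(ξ, v)` the inverse function theorem gives a smooth solution `y = Y(R(ξ, v))`. It is
affine up to an error of order `‖v - w‖²` along the segment from `v` to `w`
(`quad_solution_norm_sub_combo_le`). In the cost this error is multiplied by the small size of the
state and of `ω`, so the term `½‖v‖²` dominates and the reduced cost is strongly convex on a ball of
controls (`quadCost_combo_le`). A minimizer therefore exists, and the implicit function theorem
applied to the vanishing of the gradient makes it smooth in `(ξ, ω)` (`contDiffOn_minimizer`).

The minimizer is global for two reasons. A control outside the ball already costs more than the zero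
control, since the cost is at least `½‖v‖²`. For a control inside the ball, the state equation has
no second solution of any size (`ctrl_unique`). The passage to `V_t` rests on the du Bois-Reymond
lemma, which represents every element by its terminal value and weak derivative. -/

lemma bilin_diag_sub (B : X →L[ℝ] X →L[ℝ] X) (x y : X) :
    B x x - B y y = B x (x - y) + B (x - y) y := by
  simp only [map_sub, sub_apply]
  abel

lemma norm_bilin_le (B : X →L[ℝ] X →L[ℝ] X) {κ : ℝ} (hB : ‖B‖ ≤ κ) (x y : X) :
    ‖B x y‖ ≤ κ * ‖x‖ * ‖y‖ :=
  (B.le_opNorm₂ x y).trans (by gcongr)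

lemma norm_bilin_diag_sub_le (B : X →L[ℝ] X →L[ℝ] X) {κ ρ : ℝ} (hB : ‖B‖ ≤ κ) {x y : X}
    (hx : ‖x‖ ≤ ρ) (hy : ‖y‖ ≤ ρ) : ‖B x x - B y y‖ ≤ 2 * κ * ρ * ‖x - y‖ := by
  have hκ : 0 ≤ κ := (norm_nonneg B).trans hB
  rw [bilin_diag_sub]
  calc ‖B x (x - y) + B (x - y) y‖ ≤ κ * ‖x‖ * ‖x - y‖ + κ * ‖x - y‖ * ‖y‖ :=
        norm_add_le_of_le (norm_bilin_le B hB _ _) (norm_bilin_le B hB _ _)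
    _ ≤ κ * ρ * ‖x - y‖ + κ * ‖x - y‖ * ρ := by gcongr
    _ = _ := by ring

/-- On a ball of radius `ρ` the quadratic term has Lipschitz constant `2κρ`; the radius `1/(4κ)` is
the one that makes it `1/2`. -/
lemma quad_approximatesLinearOn (B : X →L[ℝ] X →L[ℝ] X) {κ : ℝ} (hκ : 0 < κ) (hB : ‖B‖ ≤ κ) :
    ApproximatesLinearOn (fun y => y - B y y) ((ContinuousLinearEquiv.refl ℝ X : X ≃L[ℝ] X) :
      X →L[ℝ] X) (ball 0 (1 / (4 * κ))) (1 / 2) := by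
  intro x hx y hy
  have hx' : ‖x‖ ≤ 1 / (4 * κ) := (mem_ball_zero_iff.1 hx).le
  have hy' : ‖y‖ ≤ 1 / (4 * κ) := (mem_ball_zero_iff.1 hy).le
  have h := norm_bilin_diag_sub_le B hB hx' hy'
  have e : x - B x x - (y - B y y) - ((ContinuousLinearEquiv.refl ℝ X : X ≃L[ℝ] X) :
      X →L[ℝ] X) (x - y) = -(B x x - B y y) := by
    simp only [ContinuousLinearEquiv.coe_coe, ContinuousLinearEquiv.refl_apply]
    abel
  rw [e, norm_neg]
  refine h.trans (le_of_eq ?_)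
  push_cast
  field_simp
  norm_num

lemma hasFDerivAt_quad (B : X →L[ℝ] X →L[ℝ] X) (y : X) :
    HasFDerivAt (fun y => y - B y y) (ContinuousLinearMap.id ℝ X - (B y + B.flip y)) y := by
  refine (hasFDerivAt_id y).sub ?_
  have h := B.hasFDerivAt_of_bilinear (hasFDerivAt_id y) (hasFDerivAt_id y)
  simp only [id] at h
  refine h.congr_fderiv ?_
  ext z
  simp

/-- The quadratic equation `y = η + B(y,y)` has a solution that depends smoothly on `η`, on a ball
whose radius depends only on a bound for `‖B‖`. -/
theorem exists_contDiffOn_quad_solution [CompleteSpace X] (B : X →L[ℝ] X →L[ℝ] X) {κ : ℝ}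
    (hκ : 0 < κ) (hB : ‖B‖ ≤ κ) :
    ∃ Y : X → X, ContDiffOn ℝ ∞ Y (ball 0 (1 / (16 * κ))) ∧
      ∀ η ∈ ball (0 : X) (1 / (16 * κ)), Y η = η + B (Y η) (Y η) ∧ ‖Y η‖ ≤ 1 / (4 * κ) := by
  classical
  have hA := quad_approximatesLinearOn B hκ hB
  have hc : Subsingleton X ∨ (1 / 2 : NNReal) <
      ‖((ContinuousLinearEquiv.refl ℝ X).symm : X →L[ℝ] X)‖₊⁻¹ := by
    rcases subsingleton_or_nontrivial X with h | h
    · exact Or.inl h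
    · right
      have : ‖((ContinuousLinearEquiv.refl ℝ X).symm : X →L[ℝ] X)‖₊ = 1 :=
        ContinuousLinearMap.nnnorm_id
      rw [this]
      norm_num
  set q := hA.toOpenPartialHomeomorph _ _ hc isOpen_ball with hq
  have htarget : ball (0 : X) (1 / (16 * κ)) ⊆ q.target := by
    rcases subsingleton_or_nontrivial X with h | h
    · intro η _
      refine ⟨0, by simp [hκ], Subsingleton.elim _ _⟩
    · have hN : ‖((ContinuousLinearEquiv.refl ℝ X).symm : X →L[ℝ] X)‖₊ = 1 :=
        ContinuousLinearMap.nnnorm_id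
      have h8 : closedBall (0 : X) (1 / (8 * κ)) ⊆ ball 0 (1 / (4 * κ)) := by
        apply closedBall_subset_ball
        gcongr
        norm_num
      -- The image contains a closed ball of radius `(1 - 1/2) * 1/(8κ) = 1/(16κ)`.
      have h := hA.closedBall_subset_target hc isOpen_ball (b := (0 : X)) (ε := 1 / (8 * κ))
        (by positivity) h8
      refine Subset.trans ?_ h
      rw [hN]
      simp only [map_zero, sub_zero]
      refine ball_subset_closedBall.trans (closedBall_subset_closedBall (le_of_eq ?_))
      push_cast
      field_simp
      norm_num
  refine ⟨q.symm, ?_, ?_⟩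
  · intro η hη
    have hmem : q.symm η ∈ ball (0 : X) (1 / (4 * κ)) := q.map_target (htarget hη)
    -- The derivative of `y - B(y, y)` is the identity minus this operator, hence invertible; the
    -- norm is at most `1/2`.
    have hsmall : ‖B (q.symm η) + B.flip (q.symm η)‖ < 1 := by
      have hy := mem_ball_zero_iff.1 hmem
      calc ‖B (q.symm η) + B.flip (q.symm η)‖ ≤ ‖B‖ * ‖q.symm η‖ + ‖B.flip‖ * ‖q.symm η‖ :=
            norm_add_le_of_le (B.le_opNorm _) (B.flip.le_opNorm _)
        _ ≤ κ * (1 / (4 * κ)) + κ * (1 / (4 * κ)) := by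
            rw [B.opNorm_flip]; gcongr
        _ < 1 := by field_simp; norm_num
    let u := Units.oneSub (B (q.symm η) + B.flip (q.symm η)) hsmall
    have hu : ((ContinuousLinearEquiv.unitsEquiv ℝ X u : X ≃L[ℝ] X) : X →L[ℝ] X) =
        ContinuousLinearMap.id ℝ X - (B (q.symm η) + B.flip (q.symm η)) := by
      ext x
      rfl
    refine (q.contDiffAt_symm (f₀' := ContinuousLinearEquiv.unitsEquiv ℝ X u) (htarget hη) ?_
      ?_).contDiffWithinAt
    · rw [hu]
      exact hasFDerivAt_quad B _
    · have : ContDiff ℝ ∞ fun y : X => y - B y y := by fun_prop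
      exact this.contDiffAt
  · intro η hη
    have hmem : q.symm η ∈ ball (0 : X) (1 / (4 * κ)) := q.map_target (htarget hη)
    have h : q.symm η - B (q.symm η) (q.symm η) = η := q.right_inv (htarget hη)
    exact ⟨sub_eq_iff_eq_add.1 h, (mem_ball_zero_iff.1 hmem).le⟩

lemma quad_solution_norm_le {B : X →L[ℝ] X →L[ℝ] X} {κ : ℝ} (hκ : 0 < κ) (hB : ‖B‖ ≤ κ)
    {y η : X} (h : y = η + B y y) (hy : ‖y‖ ≤ 1 / (4 * κ)) : ‖y‖ ≤ 2 * ‖η‖ := by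
  have h1 : ‖y‖ ≤ ‖η‖ + κ * ‖y‖ * ‖y‖ := by
    conv_lhs => rw [h]
    exact norm_add_le_of_le le_rfl (norm_bilin_le B hB _ _)
  have h2 : κ * ‖y‖ * ‖y‖ ≤ κ * (1 / (4 * κ)) * ‖y‖ := by gcongr
  have h3 : κ * (1 / (4 * κ)) = 1 / 4 := by field_simp
  rw [h3] at h2
  nlinarith [norm_nonneg y]

lemma quad_solution_norm_sub_le {B : X →L[ℝ] X →L[ℝ] X} {κ : ℝ} (hκ : 0 < κ) (hB : ‖B‖ ≤ κ)
    {y z η ζ : X} (hy : y = η + B y y) (hz : z = ζ + B z z) (hy' : ‖y‖ ≤ 1 / (4 * κ))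
    (hz' : ‖z‖ ≤ 1 / (4 * κ)) : ‖y - z‖ ≤ 2 * ‖η - ζ‖ := by
  have e : y - z = (η - ζ) + (B y y - B z z) := by
    conv_lhs => rw [hy, hz]
    abel
  have h1 : ‖y - z‖ ≤ ‖η - ζ‖ + 2 * κ * (1 / (4 * κ)) * ‖y - z‖ := by
    conv_lhs => rw [e]
    exact norm_add_le_of_le le_rfl (norm_bilin_diag_sub_le B hB hy' hz')
  have h3 : 2 * κ * (1 / (4 * κ)) = 1 / 2 := by field_simp; norm_num
  rw [h3] at h1
  linarith

/-- The solution of the quadratic equation is affine up to a second order error. -/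
lemma quad_solution_norm_sub_combo_le {B : X →L[ℝ] X →L[ℝ] X} {κ : ℝ} (hκ : 0 < κ) (hB : ‖B‖ ≤ κ)
    {y z w η ζ : X} {a b : ℝ} (ha : 0 ≤ a) (hb : 0 ≤ b) (hab : a + b = 1)
    (hy : y = η + B y y) (hz : z = ζ + B z z) (hw : w = (a • η + b • ζ) + B w w)
    (hy' : ‖y‖ ≤ 1 / (4 * κ)) (hz' : ‖z‖ ≤ 1 / (4 * κ)) (hw' : ‖w‖ ≤ 1 / (4 * κ)) :
    ‖w - (a • y + b • z)‖ ≤ 8 * κ * (a * b) * ‖η - ζ‖ ^ 2 := by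
  have hm' : ‖a • y + b • z‖ ≤ 1 / (4 * κ) := by
    calc ‖a • y + b • z‖ ≤ a * ‖y‖ + b * ‖z‖ := by
          refine (norm_add_le _ _).trans (le_of_eq ?_)
          rw [norm_smul, norm_smul, Real.norm_of_nonneg ha, Real.norm_of_nonneg hb]
      _ ≤ a * (1 / (4 * κ)) + b * (1 / (4 * κ)) := by gcongr
      _ = 1 / (4 * κ) := by rw [← add_mul, hab, one_mul]
  -- The identity `a B(y,y) + b B(z,z) = B(m,m) + ab B(y-z,y-z)` with `m = ay + bz` isolates the
  -- factor `ab`. The difference `B(w,w) - B(m,m)` is absorbed with constant `1/2`.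
  have e : w - (a • y + b • z) =
      (B w w - B (a • y + b • z) (a • y + b • z)) - (a * b) • B (y - z) (y - z) := by
    have hb' : b = 1 - a := by linarith
    have e1 : w - (a • y + b • z) = B w w - a • B y y - b • B z z := by
      conv_lhs => rw [hw, hy, hz]
      simp only [smul_add]
      abel
    rw [e1]
    subst hb'
    simp only [map_add, map_sub, map_smul, add_apply, sub_apply, smul_apply]
    module
  have h1 := norm_bilin_diag_sub_le B hB hw' hm'
  have h2 := norm_bilin_le B hB (y - z) (y - z)
  have h3 : 2 * κ * (1 / (4 * κ)) = 1 / 2 := by field_simp; norm_num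
  have h4 := quad_solution_norm_sub_le hκ hB hy hz hy' hz'
  rw [h3] at h1
  have h5 : ‖w - (a • y + b • z)‖ ≤ 1 / 2 * ‖w - (a • y + b • z)‖
      + a * b * (κ * (2 * ‖η - ζ‖) * (2 * ‖η - ζ‖)) := by
    conv_lhs => rw [e]
    refine norm_sub_le_of_le h1 ?_
    rw [norm_smul, Real.norm_of_nonneg (mul_nonneg ha hb)]
    gcongr
    exact h2.trans (by gcongr)
  linarith

end QuadraticFixedPoint

/-! ### Strongly convex functions: existence of minimizers and first order bound -/

section StrongConvexity

variable {H : Type*} [NormedAddCommGroup H] [NormedSpace ℝ H]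

/-- Strong convexity at midpoints forces every minimizing sequence to be Cauchy, so completeness
replaces weak compactness. -/
theorem exists_isMinOn_of_strongConvexOn [CompleteSpace H] {s : Set H} {f : H → ℝ} {m : ℝ}
    (hm : 0 < m) (hs : IsClosed s) (hne : s.Nonempty) (hf : StrongConvexOn s m f)
    (hc : ContinuousOn f s) (hb : BddBelow (f '' s)) : ∃ x ∈ s, IsMinOn f s x := by
  set I := sInf (f '' s) with hI
  have hlow : ∀ x ∈ s, I ≤ f x := fun x hx => csInf_le hb (mem_image_of_mem f hx)
  have hex : ∀ k : ℕ, ∃ x ∈ s, f x < I + 1 / (k + 1 : ℝ) := by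
    intro k
    obtain ⟨_, ⟨x, hx, rfl⟩, h⟩ := exists_lt_of_csInf_lt (hne.image f)
      (show sInf (f '' s) < I + 1 / (k + 1 : ℝ) from lt_add_of_pos_right _ (by positivity))
    exact ⟨x, hx, h⟩
  choose x hxs hx using hex
  have hdist : ∀ y ∈ s, ∀ z ∈ s, m / 8 * ‖y - z‖ ^ 2 ≤ (f y - I) / 2 + (f z - I) / 2 := by
    intro y hy z hz
    have h1 := hf.2 hy hz (by norm_num : (0 : ℝ) ≤ 1 / 2) (by norm_num : (0 : ℝ) ≤ 1 / 2) (by norm_num)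
    have h2 := hlow _ (hf.1 hy hz (by norm_num : (0 : ℝ) ≤ 1 / 2) (by norm_num : (0 : ℝ) ≤ 1 / 2)
      (by norm_num))
    simp only [smul_eq_mul] at h1
    linarith
  have hcau : CauchySeq x := by
    rw [Metric.cauchySeq_iff']
    intro ε hε
    obtain ⟨N, hN⟩ := exists_nat_one_div_lt (show 0 < m / 8 * ε ^ 2 by positivity)
    refine ⟨N, fun k hk => ?_⟩
    have h1 := hdist _ (hxs k) _ (hxs N)
    have h2 : 1 / (k + 1 : ℝ) ≤ 1 / (N + 1 : ℝ) := by gcongr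
    have h3 : m / 8 * ‖x k - x N‖ ^ 2 < m / 8 * ε ^ 2 := by
      linarith [hx k, hx N]
    rw [dist_eq_norm]
    exact lt_of_pow_lt_pow_left₀ 2 hε.le (lt_of_mul_lt_mul_left h3 (by positivity))
  obtain ⟨x₀, hx₀⟩ := cauchySeq_tendsto_of_complete hcau
  have hx₀s : x₀ ∈ s := hs.mem_of_tendsto hx₀ (Filter.Eventually.of_forall hxs)
  refine ⟨x₀, hx₀s, fun y hy => ?_⟩
  have h1 : Filter.Tendsto (fun k => f (x k)) Filter.atTop (nhds (f x₀)) :=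
    (hc x₀ hx₀s).tendsto.comp (tendsto_nhdsWithin_iff.2 ⟨hx₀, Filter.Eventually.of_forall hxs⟩)
  have h2 : Filter.Tendsto (fun k : ℕ => I + 1 / (k + 1 : ℝ)) Filter.atTop (nhds (I + 0)) :=
    tendsto_const_nhds.add tendsto_one_div_add_atTop_nhds_zero_nat
  have h3 : f x₀ ≤ I := by
    rw [add_zero] at h2
    exact le_of_tendsto_of_tendsto' h1 h2 fun k => (hx k).le
  exact h3.trans (hlow y hy)

/-- The first order lower bound for a strongly convex function. -/
lemma add_fderiv_le_of_strongConvexOn {s : Set H} {f : H → ℝ} {m : ℝ} {f' : H →L[ℝ] ℝ} {x y : H}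
    (hf : StrongConvexOn s m f) (hx : x ∈ s) (hy : y ∈ s) (hf' : HasFDerivAt f f' x) :
    f x + f' (y - x) + m / 2 * ‖y - x‖ ^ 2 ≤ f y := by
  have hline : HasDerivAt (fun τ : ℝ => f (x + τ • (y - x))) (f' (y - x)) 0 := by
    have h1 : HasDerivAt (fun τ : ℝ => x + τ • (y - x)) (y - x) 0 := by
      simpa using ((hasDerivAt_id (0 : ℝ)).smul_const (y - x)).const_add x
    have h2 : HasFDerivAt f f' (x + (0 : ℝ) • (y - x)) := by simpa using hf'
    exact h2.comp_hasDerivAt 0 h1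
  have hslope := hline.tendsto_slope_zero_right
  have hlim : Filter.Tendsto (fun τ : ℝ => f y - f x - (1 - τ) * (m / 2 * ‖y - x‖ ^ 2))
      (nhdsWithin 0 (Ioi 0)) (nhds (f y - f x - (1 - 0) * (m / 2 * ‖y - x‖ ^ 2))) :=
    (Continuous.tendsto (by fun_prop) 0).mono_left nhdsWithin_le_nhds
  have hle := le_of_tendsto_of_tendsto hslope hlim ?_
  · linarith
  filter_upwards [Ioo_mem_nhdsGT (show (0 : ℝ) < 1 by norm_num)] with τ hτ
  have h := hf.2 hx hy (by linarith [hτ.2] : 0 ≤ 1 - τ) hτ.1.le (by ring)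
  have e : (1 - τ) • x + τ • y = x + τ • (y - x) := by module
  rw [e, norm_sub_rev x y] at h
  simp only [smul_eq_mul, zero_add, zero_smul, add_zero] at h ⊢
  rw [inv_mul_le_iff₀ hτ.1]
  linarith

end StrongConvexity

/-! ### Smooth dependence of minimizers on parameters -/

section Coercive

variable {H : Type*} [NormedAddCommGroup H] [InnerProductSpace ℝ H] [CompleteSpace H]

/-- Lax–Milgram combined with the Riesz isomorphism, phrased for `B` as a map into the dual, the
form in which the implicit function theorem needs it. -/
lemma isInvertible_of_isCoercive {B : H →L[ℝ] H →L[ℝ] ℝ} (hB : IsCoercive B) :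
    B.IsInvertible := by
  have hinj : Function.Injective B := by
    rw [injective_iff_map_eq_zero]
    intro v hv
    obtain ⟨C, hC, h⟩ := hB
    have h1 := h v
    rw [hv, zero_apply] at h1
    by_contra hne
    have : 0 < ‖v‖ := norm_pos_iff.2 hne
    have : 0 < C * ‖v‖ * ‖v‖ := by positivity
    linarith
  have hsurj : Function.Surjective B := by
    intro ℓ
    refine ⟨hB.continuousLinearEquivOfBilin.symm ((InnerProductSpace.toDual ℝ H).symm ℓ), ?_⟩
    ext w
    rw [← hB.continuousLinearEquivOfBilin_apply, ContinuousLinearEquiv.apply_symm_apply,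
      InnerProductSpace.toDual_symm_apply]
  exact ⟨ContinuousLinearEquiv.ofBijective B (LinearMap.ker_eq_bot.2 hinj)
    (LinearMap.range_eq_top.2 hsurj), ContinuousLinearEquiv.coe_ofBijective _ _ _⟩

end Coercive

section SmoothMinimizer

variable {P H : Type*} [NormedAddCommGroup P] [NormedSpace ℝ P]
  [NormedAddCommGroup H] [InnerProductSpace ℝ H]

lemma hasFDerivAt_partial {j : P × H → ℝ} {p : P} {v : H} (h : DifferentiableAt ℝ j (p, v)) :
    HasFDerivAt (fun w => j (p, w)) ((fderiv ℝ j (p, v)).comp (ContinuousLinearMap.inr ℝ P H)) v :=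
  h.hasFDerivAt.comp v (hasFDerivAt_prodMk_right p v)

/-- The gradient of a strongly convex function has a coercive derivative. -/
lemma isCoercive_of_strongConvexOn {s : Set H} (hs : IsOpen s) {f : H → ℝ} {m : ℝ} (hm : 0 < m)
    (hf : StrongConvexOn s m f) {F : H → H →L[ℝ] ℝ} (hF : ∀ v ∈ s, HasFDerivAt f (F v) v)
    {v : H} (hv : v ∈ s) {B : H →L[ℝ] H →L[ℝ] ℝ} (hB : HasFDerivAt F B v) : IsCoercive B := by
  refine ⟨m, hm, fun h => ?_⟩
  have h1 : HasDerivAt (fun τ : ℝ => v + τ • h) h 0 := by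
    simpa using ((hasDerivAt_id (0 : ℝ)).smul_const h).const_add v
  have hline : HasDerivAt (fun τ : ℝ => F (v + τ • h) h) (B h h) 0 := by
    have h2 : HasFDerivAt F B (v + (0 : ℝ) • h) := by simpa using hB
    have h3 := h2.comp_hasDerivAt 0 h1
    simpa using h3.clm_apply (hasDerivAt_const (0 : ℝ) h)
  have hmem : ∀ᶠ τ : ℝ in nhdsWithin 0 (Ioi 0), v + τ • h ∈ s := by
    have : Filter.Tendsto (fun τ : ℝ => v + τ • h) (nhds 0) (nhds v) := by
      simpa using h1.continuousAt.tendsto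
    exact nhdsWithin_le_nhds (this (hs.mem_nhds hv))
  refine ge_of_tendsto hline.tendsto_slope_zero_right ?_
  filter_upwards [hmem, self_mem_nhdsWithin] with τ hτ hτ0
  have hτ0 : 0 < τ := hτ0
  -- Adding the first order bounds in both directions gives strong monotonicity of the gradient;
  -- dividing by `τ²` yields coercivity in the limit.
  have ha := add_fderiv_le_of_strongConvexOn hf hv hτ (hF v hv)
  have hb := add_fderiv_le_of_strongConvexOn hf hτ hv (hF _ hτ)
  have e1 : v + τ • h - v = τ • h := by abel
  have e2 : v - (v + τ • h) = -(τ • h) := by abel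
  rw [e1, map_smul, norm_smul, Real.norm_of_nonneg hτ0.le, smul_eq_mul] at ha
  rw [e2, map_neg, norm_neg, map_smul, norm_smul, Real.norm_of_nonneg hτ0.le, smul_eq_mul] at hb
  simp only [zero_add, zero_smul, add_zero, smul_eq_mul]
  rw [← div_eq_inv_mul, le_div_iff₀ hτ0]
  have h4 : τ * (m * ‖h‖ * ‖h‖ * τ) ≤ τ * (F (v + τ • h) h - F v h) := by nlinarith
  exact le_of_mul_le_mul_left h4 hτ0

/-- The partial gradient in `v` vanishes at the minimizer and has a coercive, hence invertible,
derivative there. The implicit function theorem gives a smooth branch of critical points, and strong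
convexity identifies this branch with `u`. -/
theorem contDiffOn_minimizer [CompleteSpace P] [CompleteSpace H] {U : Set P} (hU : IsOpen U)
    {s : Set H} (hs : IsOpen s) {j : P × H → ℝ} (hj : ContDiffOn ℝ ∞ j (U ×ˢ s)) {m : ℝ}
    (hm : 0 < m) (hconv : ∀ p ∈ U, StrongConvexOn s m fun v => j (p, v)) {u : P → H}
    (hus : ∀ p ∈ U, u p ∈ s) (hmin : ∀ p ∈ U, IsMinOn (fun v => j (p, v)) s (u p)) :
    ContDiffOn ℝ ∞ u U := by
  intro p₀ hp₀
  have hopen : IsOpen (U ×ˢ s) := hU.prod hs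
  have hdiff : ∀ p ∈ U, ∀ v ∈ s, DifferentiableAt ℝ j (p, v) := fun p hp v hv =>
    (hj.contDiffAt (hopen.mem_nhds ⟨hp, hv⟩)).differentiableAt (by simp)
  set F : P × H → H →L[ℝ] ℝ :=
    fun q => (fderiv ℝ j q).comp (ContinuousLinearMap.inr ℝ P H) with hFdef
  have hpart : ∀ p ∈ U, ∀ v ∈ s, HasFDerivAt (fun w => j (p, w)) (F (p, v)) v :=
    fun p hp v hv => hasFDerivAt_partial (hdiff p hp v hv)
  have hcrit : F (p₀, u p₀) = 0 :=
    ((hmin p₀ hp₀).isLocalMin (hs.mem_nhds (hus p₀ hp₀))).hasFDerivAt_eq_zero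
      (hpart p₀ hp₀ _ (hus p₀ hp₀))
  have hF : ContDiffAt ℝ ∞ F (p₀, u p₀) := by
    have h1 : ContDiffAt ℝ ∞ (fderiv ℝ j) (p₀, u p₀) :=
      (hj.contDiffAt (hopen.mem_nhds ⟨hp₀, hus p₀ hp₀⟩)).fderiv_right (by simp)
    exact h1.clm_comp contDiffAt_const
  have hinv : (fderiv ℝ F (p₀, u p₀) ∘L .inr ℝ P H).IsInvertible := by
    refine isInvertible_of_isCoercive (isCoercive_of_strongConvexOn hs hm (hconv p₀ hp₀)
      (F := fun v => F (p₀, v)) (hpart p₀ hp₀) (hus p₀ hp₀) ?_)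
    exact (hF.differentiableAt (by simp)).hasFDerivAt.comp _ (hasFDerivAt_prodMk_right _ _)
  have hne : (∞ : WithTop ℕ∞) ≠ 0 := by simp
  have hψ := hF.contDiffAt_implicitFunction hne hinv
  refine (hψ.congr_of_eventuallyEq ?_).contDiffWithinAt
  have hself : hF.implicitFunction hne hinv p₀ = u p₀ := hF.implicitFunction_apply_self hne hinv
  have hmem : ∀ᶠ p in nhds p₀, hF.implicitFunction hne hinv p ∈ s :=
    hψ.continuousAt (by rw [hself]; exact hs.mem_nhds (hus p₀ hp₀))
  filter_upwards [hmem, hF.eventually_apply_implicitFunction hne hinv, hU.mem_nhds hp₀]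
    with p hps hpF hpU
  have hd := hpart p hpU _ hps
  rw [hpF, hcrit] at hd
  have h1 := add_fderiv_le_of_strongConvexOn (hconv p hpU) hps (hus p hpU) hd
  have h2 := hmin p hpU hps
  simp only [zero_apply, add_zero, mem_ofPred_eq] at h1 h2
  have h3 : m / 2 * ‖u p - hF.implicitFunction hne hinv p‖ ^ 2 ≤ 0 := by linarith
  have h4 : ‖u p - hF.implicitFunction hne hinv p‖ = 0 := by
    by_contra hne'
    have : 0 < m / 2 * ‖u p - hF.implicitFunction hne hinv p‖ ^ 2 := by positivity
    linarith
  exact sub_eq_zero.1 (norm_eq_zero.1 h4)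

end SmoothMinimizer

/-! ### Strong convexity of the reduced cost and the abstract control problem -/

section Convexity

variable {W : Type*} [NormedAddCommGroup W] [InnerProductSpace ℝ W]

lemma norm_sq_combo (v w : W) {a b : ℝ} (hab : a + b = 1) :
    ‖a • v + b • w‖ ^ 2 = a * ‖v‖ ^ 2 + b * ‖w‖ ^ 2 - a * b * ‖v - w‖ ^ 2 := by
  rw [norm_add_sq_real, norm_sub_sq_real, norm_smul, norm_smul, real_inner_smul_left,
    inner_smul_right, mul_pow, mul_pow, Real.norm_eq_abs, Real.norm_eq_abs, sq_abs, sq_abs]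
  obtain rfl := eq_sub_of_add_eq hab
  ring

/-- A defect `ε` from affinity costs only `2rε` in the squared norm: small values make the loss of
convexity small. -/
lemma norm_sq_le_combo_add {z z₁ z₂ : W} {a b r ε : ℝ} (ha : 0 ≤ a) (hb : 0 ≤ b)
    (hab : a + b = 1) (hz : ‖z‖ ≤ r) (hz₁ : ‖z₁‖ ≤ r) (hz₂ : ‖z₂‖ ≤ r)
    (hε : ‖z - (a • z₁ + b • z₂)‖ ≤ ε) :
    ‖z‖ ^ 2 ≤ a * ‖z₁‖ ^ 2 + b * ‖z₂‖ ^ 2 + 2 * r * ε := by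
  have h1 := norm_sq_combo z₁ z₂ hab
  have h2 : 0 ≤ a * b * ‖z₁ - z₂‖ ^ 2 := by positivity
  have h3 : ‖a • z₁ + b • z₂‖ ≤ r := by
    calc ‖a • z₁ + b • z₂‖ ≤ a * ‖z₁‖ + b * ‖z₂‖ := by
          refine (norm_add_le _ _).trans (le_of_eq ?_)
          rw [norm_smul, norm_smul, Real.norm_of_nonneg ha, Real.norm_of_nonneg hb]
      _ ≤ a * r + b * r := by gcongr
      _ = r := by rw [← add_mul, hab, one_mul]
  have h4 : ‖z‖ - ‖a • z₁ + b • z₂‖ ≤ ε := (norm_sub_norm_le _ _).trans hε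
  have h5 : (‖z‖ - ‖a • z₁ + b • z₂‖) * (‖z‖ + ‖a • z₁ + b • z₂‖) ≤ ε * (2 * r) := by
    have hε0 : 0 ≤ ε := (norm_nonneg _).trans hε
    calc _ ≤ ε * (‖z‖ + ‖a • z₁ + b • z₂‖) := by gcongr
      _ ≤ ε * (2 * r) := by gcongr; linarith
  nlinarith

end Convexity

section AbstractControl

variable {X H Ξ W Z : Type*} [NormedAddCommGroup X] [NormedSpace ℝ X]
  [NormedAddCommGroup H]
  [NormedAddCommGroup Ξ] [NormedSpace ℝ Ξ]
  [NormedAddCommGroup W] [InnerProductSpace ℝ W]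
  [NormedAddCommGroup Z] [InnerProductSpace ℝ Z]

/-- The cost `½‖e y‖² + ½(‖v‖² + α‖w₀ - c y‖²)` of a state-control pair `(y, v)`. -/
def quadCost (e : X →L[ℝ] Z) (c : X →L[ℝ] W) (α : ℝ) (w₀ : W) (q : X × H) : ℝ :=
  1 / 2 * ‖e q.1‖ ^ 2 + 1 / 2 * (‖q.2‖ ^ 2 + α * ‖w₀ - c q.1‖ ^ 2)

lemma half_norm_sq_le_quadCost (e : X →L[ℝ] Z) (c : X →L[ℝ] W) {α : ℝ} (hα : 0 ≤ α) (w₀ : W)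
    (q : X × H) : 1 / 2 * ‖q.2‖ ^ 2 ≤ quadCost e c α w₀ q := by
  unfold quadCost
  have h1 : 0 ≤ ‖e q.1‖ ^ 2 := by positivity
  have h2 : 0 ≤ α * ‖w₀ - c q.1‖ ^ 2 := by positivity
  linarith

variable [InnerProductSpace ℝ H]

lemma contDiff_quadCost (e : X →L[ℝ] Z) (c : X →L[ℝ] W) (α : ℝ) :
    ContDiff ℝ ∞ fun q : W × (X × H) => quadCost e c α q.1 q.2 := by
  unfold quadCost
  have h1 : ContDiff ℝ ∞ fun q : W × (X × H) => ‖e q.2.1‖ ^ 2 :=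
    ContDiff.norm_sq ℝ (by fun_prop)
  have h2 : ContDiff ℝ ∞ fun q : W × (X × H) => ‖q.2.2‖ ^ 2 :=
    ContDiff.norm_sq ℝ (by fun_prop)
  have h3 : ContDiff ℝ ∞ fun q : W × (X × H) => ‖q.1 - c q.2.1‖ ^ 2 :=
    ContDiff.norm_sq ℝ (by fun_prop)
  exact (contDiff_const.mul h1).add (contDiff_const.mul (h2.add (contDiff_const.mul h3)))

lemma norm_apply_le_mul {E F : Type*} [NormedAddCommGroup E] [NormedSpace ℝ E]
    [NormedAddCommGroup F] [NormedSpace ℝ F] {L : E →L[ℝ] F} {κ r : ℝ} (hL : ‖L‖ ≤ κ) {x : E}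
    (hx : ‖x‖ ≤ r) : ‖L x‖ ≤ κ * r :=
  L.le_of_opNorm_le_of_le hL hx

/-- With `N = ab‖v - w‖²`, the control term gains `N/2`, while the two state terms together lose at
most `½(32 + 48)κ⁷ρN`. The condition `160κ⁷ρ ≤ 1` bounds this loss by `N/4`, leaving strong
convexity with modulus `1/2`. -/
lemma quadCost_combo_le {e : X →L[ℝ] Z} {c : X →L[ℝ] W} {α κ ρ : ℝ} (hκ : 1 ≤ κ) (hα : 0 ≤ α)
    (hακ : α ≤ κ) (he : ‖e‖ ≤ κ) (hc : ‖c‖ ≤ κ) (hρ : 0 ≤ ρ) (hρκ : 160 * κ ^ 7 * ρ ≤ 1)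
    {y y₁ y₂ : X} {v w : H} {w₀ : W} {a b : ℝ} (ha : 0 ≤ a) (hb : 0 ≤ b) (hab : a + b = 1)
    (hy : ‖y‖ ≤ 2 * κ * ρ) (hy₁ : ‖y₁‖ ≤ 2 * κ * ρ) (hy₂ : ‖y₂‖ ≤ 2 * κ * ρ) (hw₀ : ‖w₀‖ ≤ ρ)
    (hd : ‖y - (a • y₁ + b • y₂)‖ ≤ 8 * κ ^ 3 * (a * b) * ‖v - w‖ ^ 2) :
    quadCost e c α w₀ (y, a • v + b • w) ≤
      a * quadCost e c α w₀ (y₁, v) + b * quadCost e c α w₀ (y₂, w)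
        - a * b * (1 / 2 / 2 * ‖v - w‖ ^ 2) := by
  have hκ0 : 0 ≤ κ := by linarith
  set N := a * b * ‖v - w‖ ^ 2 with hN
  have hN0 : 0 ≤ N := by positivity
  have hd' : ‖y - (a • y₁ + b • y₂)‖ ≤ 8 * κ ^ 3 * N := hd.trans (le_of_eq (by rw [hN]; ring))
  have h1 : ‖e y‖ ^ 2 ≤ a * ‖e y₁‖ ^ 2 + b * ‖e y₂‖ ^ 2
      + 2 * (κ * (2 * κ * ρ)) * (κ * (8 * κ ^ 3 * N)) := by
    refine norm_sq_le_combo_add ha hb hab (norm_apply_le_mul he hy) (norm_apply_le_mul he hy₁)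
      (norm_apply_le_mul he hy₂) ?_
    have := norm_apply_le_mul he hd'
    simpa only [map_sub, map_add, map_smul] using this
  have hw₀c : ∀ z : X, ‖z‖ ≤ 2 * κ * ρ → ‖w₀ - c z‖ ≤ 3 * κ ^ 2 * ρ := by
    intro z hz
    refine (norm_sub_le_of_le hw₀ (norm_apply_le_mul hc hz)).trans ?_
    have : 1 * ρ ≤ κ ^ 2 * ρ := by gcongr; exact one_le_pow₀ hκ
    nlinarith
  have h2 : ‖w₀ - c y‖ ^ 2 ≤ a * ‖w₀ - c y₁‖ ^ 2 + b * ‖w₀ - c y₂‖ ^ 2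
      + 2 * (3 * κ ^ 2 * ρ) * (κ * (8 * κ ^ 3 * N)) := by
    refine norm_sq_le_combo_add ha hb hab (hw₀c y hy) (hw₀c _ hy₁) (hw₀c _ hy₂) ?_
    have e1 : w₀ - c y - (a • (w₀ - c y₁) + b • (w₀ - c y₂)) = -(c (y - (a • y₁ + b • y₂))) := by
      obtain rfl := eq_sub_of_add_eq hab
      simp only [map_sub, map_add, map_smul]
      module
    rw [e1, norm_neg]
    exact norm_apply_le_mul hc hd'
  have h3 := norm_sq_combo v w hab
  have h4 : α * ‖w₀ - c y‖ ^ 2 ≤ a * (α * ‖w₀ - c y₁‖ ^ 2) + b * (α * ‖w₀ - c y₂‖ ^ 2)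
      + 48 * κ ^ 7 * ρ * N := by
    calc α * ‖w₀ - c y‖ ^ 2 ≤ α * (a * ‖w₀ - c y₁‖ ^ 2 + b * ‖w₀ - c y₂‖ ^ 2
          + 2 * (3 * κ ^ 2 * ρ) * (κ * (8 * κ ^ 3 * N))) := by gcongr
      _ = a * (α * ‖w₀ - c y₁‖ ^ 2) + b * (α * ‖w₀ - c y₂‖ ^ 2)
          + α * (48 * κ ^ 6 * ρ * N) := by ring
      _ ≤ a * (α * ‖w₀ - c y₁‖ ^ 2) + b * (α * ‖w₀ - c y₂‖ ^ 2)
          + κ * (48 * κ ^ 6 * ρ * N) := by gcongr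
      _ = _ := by ring
  have h5 : 32 * κ ^ 6 * ρ * N ≤ 32 * κ ^ 7 * ρ * N := by
    gcongr
    norm_num
  have h6 : 160 * κ ^ 7 * ρ * N ≤ 1 * N := by gcongr
  unfold quadCost
  simp only
  have h7 : a * b * (1 / 2 / 2 * ‖v - w‖ ^ 2) = N / 4 := by rw [hN]; ring
  have h8 : 2 * (κ * (2 * κ * ρ)) * (κ * (8 * κ ^ 3 * N)) = 32 * κ ^ 6 * ρ * N := by ring
  rw [h7]
  rw [h8] at h1
  rw [← hN] at h3
  linarith

/-- A radius, depending only on the bound `κ`, on which the control problem is uniquely and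
smoothly solvable. -/
def controlRadius (κ : ℝ) : ℝ := 1 / (1280 * κ ^ 10)

lemma controlRadius_pos {κ : ℝ} (hκ : 0 < κ) : 0 < controlRadius κ := by
  unfold controlRadius
  positivity

/-- The reduced cost is convex only for controls below `ρ`, but the competitors are arbitrary.
Controls of norm at least `ρ/2` lose to the zero control, and `huniq` excludes additional states for
the others. -/
theorem exists_smooth_minimizer [CompleteSpace X] [CompleteSpace H] [CompleteSpace Ξ]
    [CompleteSpace W] (R : Ξ × H →L[ℝ] X) (B : X →L[ℝ] X →L[ℝ] X) (e : X →L[ℝ] Z)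
    (c : X →L[ℝ] W) {α κ : ℝ} (hκ : 1 ≤ κ) (hR : ‖R‖ ≤ κ) (hB : ‖B‖ ≤ κ) (he : ‖e‖ ≤ κ)
    (hc : ‖c‖ ≤ κ) (hα : 0 ≤ α) (hακ : α ≤ κ)
    (huniq : ∀ η y z : X, y = η + B y y → z = η + B z z → y = z) :
    ∃ S : Ξ × W → X × H, ContDiffOn ℝ ∞ S (ball 0 (controlRadius κ)) ∧
      ∀ p ∈ ball (0 : Ξ × W) (controlRadius κ),
        (S p).1 = R (p.1, (S p).2) + B (S p).1 (S p).1 ∧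
        ∀ q : X × H, q.1 = R (p.1, q.2) + B q.1 q.1 →
          quadCost e c α p.2 (S p) ≤ quadCost e c α p.2 q ∧
          (quadCost e c α p.2 q ≤ quadCost e c α p.2 (S p) → q = S p) := by
  have hκ0 : 0 < κ := by linarith
  obtain ⟨Y, hYs, hY⟩ := exists_contDiffOn_quad_solution B hκ0 hB
  set ρ : ℝ := 1 / (160 * κ ^ 7) with hρ
  set δ : ℝ := controlRadius κ with hδ
  have hρ0 : 0 < ρ := by positivity
  have hρκ : 160 * κ ^ 7 * ρ = 1 := by rw [hρ]; field_simp
  have hδ0 : 0 < δ := controlRadius_pos hκ0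
  -- The data radius `δ` is chosen so that the zero control costs at most `6.5κ⁶δ²`, below the
  -- threshold `½(ρ/2)² = 8κ⁶δ²`.
  have hδρ : δ * (8 * κ ^ 3) = ρ := by rw [hδ, hρ, controlRadius]; field_simp; norm_num
  have hδle : δ ≤ ρ := by
    have : (1 : ℝ) ≤ κ ^ 3 := one_le_pow₀ hκ
    nlinarith
  have hRb : ∀ r : ℝ, ∀ (ξ : Ξ) (v : H), ‖ξ‖ ≤ r → ‖v‖ ≤ r → ‖R (ξ, v)‖ ≤ κ * r :=
    fun r ξ v h1 h2 => norm_apply_le_mul hR (max_le h1 h2)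
  have hin : ∀ (ξ : Ξ) (v : H), ‖ξ‖ ≤ ρ → ‖v‖ ≤ ρ → R (ξ, v) ∈ ball (0 : X) (1 / (16 * κ)) := by
    intro ξ v h1 h2
    rw [mem_ball_zero_iff]
    refine (hRb ρ ξ v h1 h2).trans_lt ?_
    rw [lt_div_iff₀ (by positivity)]
    have h3 : (1 : ℝ) ≤ κ ^ 5 := one_le_pow₀ hκ
    have h4 : 160 * κ ^ 7 * ρ = κ ^ 5 * (160 * (κ ^ 2 * ρ)) := by ring
    have h5 : 0 < κ ^ 2 * ρ := by positivity
    nlinarith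
  have hYb : ∀ r ≤ ρ, ∀ (ξ : Ξ) (v : H), ‖ξ‖ ≤ r → ‖v‖ ≤ r → ‖Y (R (ξ, v))‖ ≤ 2 * κ * r := by
    intro r hr ξ v h1 h2
    have h := hY _ (hin ξ v (h1.trans hr) (h2.trans hr))
    have h3 := quad_solution_norm_le hκ0 hB h.1 h.2
    have h4 := hRb r ξ v h1 h2
    linarith
  set j : (Ξ × W) × H → ℝ :=
    fun q => quadCost e c α q.1.2 (Y (R (q.1.1, q.2)), q.2) with hj
  have hmem : ∀ p ∈ ball (0 : Ξ × W) δ, ‖p.1‖ < δ ∧ ‖p.2‖ < δ := fun p hp =>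
    max_lt_iff.1 (mem_ball_zero_iff.1 hp)
  have hYsm : ContDiffOn ℝ ∞ (fun q : (Ξ × W) × H => Y (R (q.1.1, q.2)))
      (ball 0 δ ×ˢ ball 0 ρ) := by
    refine hYs.comp (ContDiff.contDiffOn (by fun_prop)) ?_
    rintro ⟨p, v⟩ ⟨hp, hv⟩
    exact hin _ _ ((hmem p hp).1.le.trans hδle) (mem_ball_zero_iff.1 hv).le
  have hjs : ContDiffOn ℝ ∞ j (ball 0 δ ×ˢ ball 0 ρ) := by
    have h2 : ContDiffOn ℝ ∞ (fun q : (Ξ × W) × H => (q.1.2, (Y (R (q.1.1, q.2)), q.2)))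
        (ball 0 δ ×ˢ ball 0 ρ) :=
      (ContDiff.contDiffOn (by fun_prop)).prodMk
        (hYsm.prodMk (ContDiff.contDiffOn (by fun_prop)))
    exact (contDiff_quadCost e c α).comp_contDiffOn h2
  have hconv : ∀ p ∈ ball (0 : Ξ × W) δ, StrongConvexOn (ball (0 : H) ρ) (1 / 2)
      fun v => j (p, v) := by
    intro p hp
    refine ⟨convex_ball _ _, fun v hv w hw a b ha hb hab => ?_⟩
    have hξ : ‖p.1‖ ≤ ρ := (hmem p hp).1.le.trans hδle
    have hv' : ‖v‖ ≤ ρ := (mem_ball_zero_iff.1 hv).le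
    have hw' : ‖w‖ ≤ ρ := (mem_ball_zero_iff.1 hw).le
    have hm' : ‖a • v + b • w‖ ≤ ρ :=
      (mem_ball_zero_iff.1 (convex_ball (0 : H) ρ hv hw ha hb hab)).le
    have e1 : R (p.1, a • v + b • w) = a • R (p.1, v) + b • R (p.1, w) := by
      rw [← map_smul, ← map_smul, ← map_add]
      congr 1
      refine Prod.ext ?_ rfl
      change p.1 = a • p.1 + b • p.1
      rw [← add_smul, hab, one_smul]
    have e2 : ‖R (p.1, v) - R (p.1, w)‖ ≤ κ * ‖v - w‖ := by
      rw [← map_sub]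
      refine norm_apply_le_mul hR (max_le ?_ le_rfl)
      simp
    have hv1 := hY _ (hin _ _ hξ hv')
    have hw1 := hY _ (hin _ _ hξ hw')
    have hm1 := hY _ (hin _ _ hξ hm')
    have hd := quad_solution_norm_sub_combo_le hκ0 hB ha hb hab hv1.1 hw1.1
      (w := Y (R (p.1, a • v + b • w))) (by rw [← e1]; exact hm1.1) hv1.2 hw1.2 hm1.2
    refine quadCost_combo_le hκ hα hακ he hc hρ0.le hρκ.le ha hb hab (hYb ρ le_rfl _ _ hξ hm')
      (hYb ρ le_rfl _ _ hξ hv') (hYb ρ le_rfl _ _ hξ hw') ((hmem p hp).2.le.trans hδle)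
      (hd.trans ?_)
    calc 8 * κ * (a * b) * ‖R (p.1, v) - R (p.1, w)‖ ^ 2
        ≤ 8 * κ * (a * b) * (κ * ‖v - w‖) ^ 2 := by gcongr
      _ = 8 * κ ^ 3 * (a * b) * ‖v - w‖ ^ 2 := by ring
  have hzero : ∀ p ∈ ball (0 : Ξ × W) δ, j (p, 0) < 1 / 2 * (ρ / 2) ^ 2 := by
    intro p hp
    have hy : ‖Y (R (p.1, (0 : H)))‖ ≤ 2 * κ * δ :=
      hYb δ hδle _ _ (hmem p hp).1.le (by rw [norm_zero]; exact hδ0.le)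
    have h1 : ‖e (Y (R (p.1, (0 : H))))‖ ≤ κ * (2 * κ * δ) := norm_apply_le_mul he hy
    have h2 : ‖p.2 - c (Y (R (p.1, (0 : H))))‖ ≤ 3 * κ ^ 2 * δ := by
      refine (norm_sub_le_of_le (hmem p hp).2.le (norm_apply_le_mul hc hy)).trans ?_
      have : 1 * δ ≤ κ ^ 2 * δ := by gcongr; exact one_le_pow₀ hκ
      nlinarith
    have h3 : j (p, 0) ≤ 1 / 2 * (κ * (2 * κ * δ)) ^ 2 + 1 / 2 * (κ * (3 * κ ^ 2 * δ) ^ 2) := by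
      simp only [hj, quadCost, norm_zero, ne_eq, OfNat.ofNat_ne_zero, not_false_eq_true,
        zero_pow, zero_add]
      gcongr
    refine h3.trans_lt ?_
    rw [← hδρ]
    have h4 : κ ^ 4 * δ ^ 2 ≤ κ ^ 6 * δ ^ 2 := by gcongr; norm_num
    have h5 : κ ^ 5 * δ ^ 2 ≤ κ ^ 6 * δ ^ 2 := by gcongr; norm_num
    have h6 : 0 < κ ^ 6 * δ ^ 2 := by positivity
    nlinarith
  have hlow : ∀ p v, 1 / 2 * ‖v‖ ^ 2 ≤ j (p, v) := fun p v =>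
    half_norm_sq_le_quadCost e c hα p.2 (Y (R (p.1, v)), v)
  have hsub : closedBall (0 : H) (ρ / 2) ⊆ ball 0 ρ := closedBall_subset_ball (by linarith)
  have hlarge : ∀ p ∈ ball (0 : Ξ × W) δ, ∀ q : X × H, ρ / 2 ≤ ‖q.2‖ →
      j (p, 0) < quadCost e c α p.2 q := by
    intro p hp q hq
    refine (hzero p hp).trans_le (le_trans ?_ (half_norm_sq_le_quadCost e c hα p.2 q))
    gcongr
  -- Existence is obtained on the closed ball of radius `ρ/2`; comparison with the zero control
  -- moves the minimizer off its boundary and extends minimality to the open ball of radius `ρ`.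
  have hex : ∀ p ∈ ball (0 : Ξ × W) δ, ∃ v ∈ ball (0 : H) (ρ / 2),
      IsMinOn (fun v => j (p, v)) (ball 0 ρ) v := by
    intro p hp
    obtain ⟨v, hv, hmin⟩ := exists_isMinOn_of_strongConvexOn (by norm_num : (0 : ℝ) < 1 / 2)
      (isClosed_closedBall (x := (0 : H)) (ε := ρ / 2))
      ⟨0, mem_closedBall_self (by positivity)⟩
      (f := fun v => j (p, v))
      ⟨convex_closedBall _ _, fun x hx y hy => (hconv p hp).2 (hsub hx) (hsub hy)⟩
      (hjs.continuousOn.comp (Continuous.continuousOn (by fun_prop))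
        fun v hv => ⟨hp, hsub hv⟩)
      ⟨0, by rintro _ ⟨v, _, rfl⟩; exact le_trans (by positivity) (hlow p v)⟩
    have h0 : j (p, v) ≤ j (p, 0) := hmin (mem_closedBall_self (by positivity))
    refine ⟨v, ?_, fun w hw => ?_⟩
    · by_contra hcon
      rw [mem_ball_zero_iff, not_lt] at hcon
      exact absurd h0 (not_le.2 (hlarge p hp (Y (R (p.1, v)), v) hcon))
    · rcases le_or_gt ‖w‖ (ρ / 2) with h | h
      · exact hmin (mem_closedBall_zero_iff.2 h)
      · exact h0.trans (hlarge p hp (Y (R (p.1, w)), w) h.le).le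
  choose! u hu hmin using hex
  have hur : ∀ p ∈ ball (0 : Ξ × W) δ, u p ∈ ball (0 : H) ρ := fun p hp =>
    hsub (ball_subset_closedBall (hu p hp))
  have husm : ContDiffOn ℝ ∞ u (ball 0 δ) :=
    contDiffOn_minimizer isOpen_ball isOpen_ball hjs (by norm_num) hconv hur hmin
  refine ⟨fun p => (Y (R (p.1, u p)), u p), ?_, fun p hp => ⟨?_, fun q hq => ?_⟩⟩
  · refine ContDiffOn.prodMk ?_ husm
    exact hYsm.comp (contDiffOn_id.prodMk husm) fun p hp => ⟨hp, hur p hp⟩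
  · exact (hY _ (hin _ _ ((hmem p hp).1.le.trans hδle) (mem_ball_zero_iff.1 (hur p hp)).le)).1
  · have h0 : j (p, u p) ≤ j (p, 0) := hmin p hp (mem_ball_self hρ0)
    rcases lt_or_ge ‖q.2‖ (ρ / 2) with h | h
    · have hq2 : q.2 ∈ ball (0 : H) ρ := mem_ball_zero_iff.2 (by linarith)
      have hYq : Y (R (p.1, q.2)) = q.1 := huniq _ _ _
        (hY _ (hin _ _ ((hmem p hp).1.le.trans hδle) (mem_ball_zero_iff.1 hq2).le)).1 hq
      have hjq : quadCost e c α p.2 q = j (p, q.2) := by simp only [hj, hYq]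
      rw [hjq]
      refine ⟨hmin p hp hq2, fun hle => ?_⟩
      have hq2u : q.2 = u p := by
        refine ((hconv p hp).strictConvexOn (by norm_num)).eq_of_isMinOn ?_
          (hmin p hp) hq2 (hur p hp)
        exact fun w hw => hle.trans (hmin p hp hw)
      refine Prod.ext ?_ hq2u
      rw [← hYq, hq2u]
    · have h1 := hlarge p hp q h
      have h2 : j (p, u p) < quadCost e c α p.2 q := h0.trans_lt h1
      exact ⟨h2.le, fun hle => absurd hle (not_le.2 h2)⟩

end AbstractControl

/-! ### Weak derivatives and the du Bois-Reymond lemma -/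

section WeakDerivative

variable {d : ℕ}

lemma exists_Icc_of_isCompact_subset_Ioo {K : Set ℝ} (hK : IsCompact K) {a b : ℝ} (hab : a < b)
    (h : K ⊆ Ioo a b) : ∃ a' b', a < a' ∧ a' ≤ b' ∧ b' < b ∧ K ⊆ Icc a' b' := by
  rcases K.eq_empty_or_nonempty with rfl | hne
  · exact ⟨(a + b) / 2, (a + b) / 2, by linarith, le_rfl, by linarith, empty_subset _⟩
  · obtain ⟨x, hx, hx'⟩ := hK.exists_isLeast hne
    obtain ⟨y, hy, hy'⟩ := hK.exists_isGreatest hne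
    exact ⟨x, y, (h hx).1, hx' hy, (h hy).2, fun z hz => ⟨hx' hz, hy' hz⟩⟩

/-- A test function with zero mean is the derivative of a test function. -/
lemma exists_testFunction_deriv_eq {t : ℝ} (ht : 0 < t) {φ : ℝ → ℝ} (hφ : ContDiff ℝ ∞ φ)
    (hc : HasCompactSupport φ) (hs : tsupport φ ⊆ Ioo 0 t) (hz : ∫ s, φ s = 0) :
    ∃ ψ : ℝ → ℝ, ContDiff ℝ ∞ ψ ∧ HasCompactSupport ψ ∧ tsupport ψ ⊆ Ioo 0 t ∧ deriv ψ = φ := by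
  obtain ⟨a, b, ha, hab, hb, hK⟩ := exists_Icc_of_isCompact_subset_Ioo hc.isCompact ht hs
  have hout : ∀ s, s ∉ Icc a b → φ s = 0 := fun s h =>
    image_eq_zero_of_notMem_tsupport fun h' => h (hK h')
  have hint : ∀ u v, IntervalIntegrable φ volume u v := fun u v =>
    hφ.continuous.intervalIntegrable u v
  set ψ : ℝ → ℝ := fun s => ∫ x in a..s, φ x with hψ
  have hd : ∀ s, HasDerivAt ψ (φ s) s := fun s =>
    intervalIntegral.integral_hasDerivAt_right (hint _ _)
      (hφ.continuous.stronglyMeasurableAtFilter _ _) hφ.continuous.continuousAt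
  have hderiv : deriv ψ = φ := funext fun s => (hd s).deriv
  -- The zero mean is what makes the primitive vanish to the right of `b`.
  have hab0 : ∫ x in a..b, φ x = 0 := by
    rw [intervalIntegral.integral_of_le hab, ← integral_Icc_eq_integral_Ioc,
      setIntegral_eq_integral_of_forall_compl_eq_zero hout, hz]
  have hψout : ∀ s, s ∉ Icc a b → ψ s = 0 := by
    intro s h
    rcases lt_or_ge s a with h1 | h1
    · have h3 : EqOn φ 0 (Ico s a) := fun x hx => hout x fun h' => absurd h'.1 (not_le.2 hx.2)
      rw [hψ]
      simp only
      rw [intervalIntegral.integral_symm, intervalIntegral.integral_of_le h1.le,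
        ← integral_Ico_eq_integral_Ioc, setIntegral_congr_fun measurableSet_Ico h3]
      simp
    · have h2 : b < s := not_le.1 fun h' => h ⟨h1, h'⟩
      have h3 : EqOn φ 0 (Ioc b s) := fun x hx => hout x fun h' => absurd h'.2 (not_le.2 hx.1)
      rw [hψ]
      simp only
      rw [← intervalIntegral.integral_add_adjacent_intervals (hint a b) (hint b s), hab0,
        intervalIntegral.integral_of_le h2.le, setIntegral_congr_fun measurableSet_Ioc h3]
      simp
  have hts : tsupport ψ ⊆ Icc a b :=
    closure_minimal (fun s h => by_contra fun h' => h (hψout s h')) isClosed_Icc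
  refine ⟨ψ, ?_, isCompact_Icc.of_isClosed_subset (isClosed_tsupport _) hts,
    hts.trans fun s h => ⟨ha.trans_le h.1, h.2.trans_lt hb⟩, hderiv⟩
  rw [contDiff_infty_iff_deriv, hderiv]
  exact ⟨fun s => (hd s).differentiableAt, hφ⟩

/-- The **du Bois-Reymond lemma**. -/
lemma exists_const_of_integral_deriv_smul_eq_zero {t : ℝ} (ht : 0 < t) {h : ℝ → E d}
    (hc : Continuous h)
    (H : ∀ ψ : ℝ → ℝ, ContDiff ℝ ∞ ψ → HasCompactSupport ψ → tsupport ψ ⊆ Ioo (0 : ℝ) t →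
      ∫ s in Ioc (0 : ℝ) t, deriv ψ s • h s = 0) :
    ∃ c, ∀ s ∈ Icc 0 t, h s = c := by
  let f : ContDiffBump (t / 2) := ⟨t / 8, t / 4, by linarith, by linarith⟩
  set φ₀ : ℝ → ℝ := f.normed volume with hφ₀
  have h0s : ContDiff ℝ ∞ φ₀ := f.contDiff_normed
  have h0c : HasCompactSupport φ₀ := f.hasCompactSupport_normed
  have h0i : ∫ s, φ₀ s = 1 := f.integral_normed
  have h0t : tsupport φ₀ ⊆ Ioo 0 t := by
    rw [hφ₀, f.tsupport_normed_eq, Real.closedBall_eq_Icc]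
    intro s hs
    have h1 : t / 2 - t / 4 ≤ s := hs.1
    have h2 : s ≤ t / 2 + t / 4 := hs.2
    exact ⟨by linarith, by linarith⟩
  set c : E d := ∫ s in Ioc 0 t, φ₀ s • h s with hcdef
  have hset : ∀ φ : ℝ → ℝ, tsupport φ ⊆ Ioo 0 t → ∀ g : ℝ → E d,
      ∫ s, φ s • g s = ∫ s in Ioc 0 t, φ s • g s := by
    intro φ hφ g
    refine (setIntegral_eq_integral_of_forall_compl_eq_zero fun s hs => ?_).symm
    rw [image_eq_zero_of_notMem_tsupport fun h' => hs (Ioo_subset_Ioc_self (hφ h')), zero_smul]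
  have hint : ∀ φ : ℝ → ℝ, Continuous φ → HasCompactSupport φ → ∀ g : ℝ → E d, Continuous g →
      Integrable (fun s => φ s • g s) := fun φ h1 h2 g h3 =>
    (h1.smul h3).integrable_of_hasCompactSupport h2.smul_right
  have key : ∀ᵐ x : ℝ, x ∈ Ioo 0 t → h x - c = 0 := by
    refine isOpen_Ioo.ae_eq_zero_of_integral_contDiff_smul_eq_zero
      ((hc.sub continuous_const).locallyIntegrable.locallyIntegrableOn _) ?_
    intro φ hφs hφc hφt
    -- Subtracting `μ φ₀` removes the mean of `φ`, so the difference is the derivative of a test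
    -- function.
    set μ := ∫ s, φ s with hμ
    have h1s : ContDiff ℝ ∞ (fun s => φ s - μ * φ₀ s) := by fun_prop
    have h1c : HasCompactSupport (fun s => φ s - μ * φ₀ s) :=
      hφc.sub (h0c.mul_left (f := fun _ => μ))
    have h1t : tsupport (fun s => φ s - μ * φ₀ s) ⊆ Ioo 0 t := by
      refine (tsupport_sub φ (fun s => μ * φ₀ s)).trans (union_subset hφt ?_)
      exact (tsupport_mul_subset_right (f := fun _ => μ) (g := φ₀)).trans h0t
    have h1z : ∫ s, (φ s - μ * φ₀ s) = 0 := by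
      rw [integral_sub (hφs.continuous.integrable_of_hasCompactSupport hφc)
        ((h0s.continuous.integrable_of_hasCompactSupport h0c).const_mul μ),
        integral_const_mul, h0i, mul_one, sub_self]
    obtain ⟨ψ, hψs, hψc, hψt, hψ⟩ := exists_testFunction_deriv_eq ht h1s h1c h1t h1z
    have h2 := H ψ hψs hψc hψt
    rw [hψ, ← hset _ h1t] at h2
    have e : ∀ s, (φ s - μ * φ₀ s) • h s = φ s • h s - μ • (φ₀ s • h s) := fun s => by
      rw [sub_smul, mul_smul]
    simp only [e] at h2
    have hi : Integrable fun s => μ • φ₀ s • h s := (hint φ₀ h0s.continuous h0c h hc).smul μ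
    rw [integral_sub (hint φ hφs.continuous hφc h hc) hi, integral_smul, hset φ₀ h0t, ← hcdef] at h2
    simp only [smul_sub]
    rw [integral_sub (hint φ hφs.continuous hφc h hc)
      (hint φ hφs.continuous hφc _ continuous_const), integral_smul_const]
    exact h2
  refine ⟨c, fun s hs => ?_⟩
  refine Measure.eqOn_Icc_of_ae_eq volume ht.ne (f := h) (g := fun _ => c) ?_ hc.continuousOn
    continuousOn_const hs
  rw [Measure.restrict_congr_set Ioo_ae_eq_Icc.symm]
  rw [Filter.EventuallyEq, ae_restrict_iff' measurableSet_Ioo]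
  filter_upwards [key] with x hx hx'
  exact sub_eq_zero.1 (hx hx')

/-- Integration by parts for the primitive vanishing at the right end point. -/
lemma integral_deriv_smul_integral_Ioc {t : ℝ} {g : ℝ → E d} (hg : IntegrableOn g (Ioc 0 t))
    {ψ : ℝ → ℝ} (hψ : ContDiff ℝ ∞ ψ) (h0 : ψ 0 = 0) :
    ∫ s in Ioc 0 t, deriv ψ s • ∫ r in Ioc s t, g r = ∫ r in Ioc 0 t, ψ r • g r := by
  set μ := (volume : Measure ℝ).restrict (Ioc 0 t) with hμ
  have hψ' : Continuous (deriv ψ) := hψ.continuous_deriv (by simp)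
  have hψi : Integrable (deriv ψ) μ :=
    (hψ'.integrableOn_Icc (a := 0) (b := t)).mono_set Ioc_subset_Icc_self
  have hmeas : MeasurableSet {p : ℝ × ℝ | p.1 < p.2} :=
    measurableSet_lt measurable_fst measurable_snd
  -- Fubini on the triangle `s < r`.
  set F : ℝ × ℝ → E d := {p : ℝ × ℝ | p.1 < p.2}.indicator fun p => deriv ψ p.1 • g p.2 with hF
  have hFi : Integrable F (μ.prod μ) := (hψi.smul_prod hg).indicator hmeas
  have hswap := integral_integral_swap (f := fun s r => F (s, r)) hFi
  have hl : ∫ s, ∫ r, F (s, r) ∂μ ∂μ = ∫ s in Ioc 0 t, deriv ψ s • ∫ r in Ioc s t, g r := by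
    refine setIntegral_congr_fun measurableSet_Ioc fun s hs => ?_
    have e : ∀ r, F (s, r) = deriv ψ s • (Ioi s).indicator g r := by
      intro r
      simp only [hF, indicator, mem_ofPred_eq, mem_Ioi]
      split_ifs <;> simp
    simp only [e]
    rw [integral_smul, hμ, setIntegral_indicator measurableSet_Ioi]
    congr 3
    ext r
    exact ⟨fun h => ⟨h.2, h.1.2⟩, fun h => ⟨⟨hs.1.trans h.1, h.2⟩, h.1⟩⟩
  have hr : ∫ r, ∫ s, F (s, r) ∂μ ∂μ = ∫ r in Ioc 0 t, ψ r • g r := by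
    refine setIntegral_congr_fun measurableSet_Ioc fun r hr => ?_
    have e : ∀ s, F (s, r) = (Iio r).indicator (deriv ψ) s • g r := by
      intro s
      simp only [hF, indicator, mem_ofPred_eq, mem_Iio]
      split_ifs <;> simp
    simp only [e]
    rw [integral_smul_const, hμ, setIntegral_indicator measurableSet_Iio]
    congr 1
    have e2 : Ioc 0 t ∩ Iio r = Ioo 0 r := by
      ext s
      exact ⟨fun h => ⟨h.1.1, h.2⟩, fun h => ⟨⟨h.1, h.2.le.trans hr.2⟩, h.2⟩⟩
    rw [e2, ← integral_Ioc_eq_integral_Ioo, ← intervalIntegral.integral_of_le hr.1.le,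
      intervalIntegral.integral_deriv_eq_sub (fun x _ => (hψ.differentiable (by simp)) x)
        (hψ'.intervalIntegrable _ _), h0, sub_zero]
  rw [← hl, ← hr, hswap]

end WeakDerivative

/-! ### Continuous curves, primitives and the structure of `V_t` -/

section Curve

/-- The Banach space `C([0,t];ℝ^d)`. -/
def Curve (t : ℝ) (d : ℕ) : Type := C(Icc (0 : ℝ) t, E d)

namespace Curve

variable {d : ℕ} {t : ℝ}

instance : NormedAddCommGroup (Curve t d) := inferInstanceAs (NormedAddCommGroup C(Icc 0 t, E d))

instance : NormedSpace ℝ (Curve t d) := inferInstanceAs (NormedSpace ℝ C(Icc 0 t, E d))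

instance : CompleteSpace (Curve t d) := inferInstanceAs (CompleteSpace C(Icc 0 t, E d))

instance : FunLike (Curve t d) (Icc (0 : ℝ) t) (E d) :=
  inferInstanceAs (FunLike C(Icc 0 t, E d) (Icc 0 t) (E d))

/-- The curve given by a continuous function. -/
def mk (f : Icc (0 : ℝ) t → E d) (hf : Continuous f) : Curve t d := (⟨f, hf⟩ : C(Icc 0 t, E d))

@[ext] lemma ext {f g : Curve t d} (h : ∀ s, f s = g s) : f = g := DFunLike.ext _ _ h

@[simp] lemma mk_apply (f : Icc (0 : ℝ) t → E d) (hf : Continuous f) (s : Icc (0 : ℝ) t) :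
    mk f hf s = f s := rfl

@[fun_prop]
protected lemma continuous (f : Curve t d) : Continuous f :=
  ContinuousMap.continuous (f : C(Icc 0 t, E d))

@[simp] lemma add_apply (f g : Curve t d) (s : Icc (0 : ℝ) t) : (f + g) s = f s + g s := rfl

@[simp] lemma sub_apply (f g : Curve t d) (s : Icc (0 : ℝ) t) : (f - g) s = f s - g s := rfl

@[simp] lemma smul_apply (c : ℝ) (f : Curve t d) (s : Icc (0 : ℝ) t) : (c • f) s = c • f s := rfl

lemma norm_coe_le_norm (f : Curve t d) (s : Icc (0 : ℝ) t) : ‖f s‖ ≤ ‖f‖ :=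
  ContinuousMap.norm_coe_le_norm (f : C(Icc 0 t, E d)) s

lemma norm_le {f : Curve t d} {c : ℝ} (hc : 0 ≤ c) : ‖f‖ ≤ c ↔ ∀ s, ‖f s‖ ≤ c :=
  ContinuousMap.norm_le (f : C(Icc 0 t, E d)) hc

variable (d t) in
/-- The identity map from curves to bundled continuous maps. -/
def toContinuousMap : Curve t d →L[ℝ] C(Icc 0 t, E d) where
  toFun f := f
  map_add' _ _ := rfl
  map_smul' _ _ := rfl
  cont := continuous_id

/-- Evaluation of curves at a point. -/
def eval (s : Icc (0 : ℝ) t) : Curve t d →L[ℝ] E d :=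
  LinearMap.mkContinuous
    { toFun := fun f => f s
      map_add' := fun _ _ => rfl
      map_smul' := fun _ _ => rfl } 1 fun f => by
    rw [one_mul]
    exact f.norm_coe_le_norm s

lemma norm_eval_le (s : Icc (0 : ℝ) t) : ‖(eval s : Curve t d →L[ℝ] E d)‖ ≤ 1 :=
  LinearMap.mkContinuous_norm_le _ zero_le_one _

end Curve

/-- The continuous representative of `x ∈ V_t`. -/
def V.curve {t : ℝ} {d : ℕ} (x : V t d) : Curve t d := x.1.2

end Curve

section Operators

variable {d : ℕ} {t : ℝ}

lemma memLp_IccExtend (ht : 0 ≤ t) (f : Curve t d) :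
    MemLp (IccExtend ht f) 2 (volume.restrict (Ioc 0 t)) := by
  refine MemLp.of_bound f.continuous.Icc_extend'.aestronglyMeasurable ‖f‖ ?_
  exact Filter.Eventually.of_forall fun s => f.norm_coe_le_norm _

lemma measureUnivNNReal_rpow_le (ht : 0 ≤ t) :
    (measureUnivNNReal ((volume : Measure ℝ).restrict (Ioc 0 t)) : ℝ) ^
      (ENNReal.toReal 2)⁻¹ ≤ 1 + t := by
  have h : (measureUnivNNReal ((volume : Measure ℝ).restrict (Ioc 0 t)) : ℝ) = t := by
    simp [measureUnivNNReal, ENNReal.coe_toNNReal_eq_toReal, ENNReal.toReal_ofReal ht]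
  rw [h, ENNReal.toReal_ofNat, ← one_div, ← Real.sqrt_eq_rpow, Real.sqrt_le_left (by linarith)]
  nlinarith

/-- The inclusion `C([0,t];ℝ^d) → L²(0,t;ℝ^d)`. -/
def inclL2 (ht : 0 ≤ t) : Curve t d →L[ℝ] L2 t d :=
  LinearMap.mkContinuous
    { toFun := fun f => (memLp_IccExtend ht f).toLp _
      map_add' := fun _ _ => rfl
      map_smul' := fun _ _ => rfl } (1 + t) fun f => by
    refine (Lp.norm_le_of_ae_bound (norm_nonneg f) ?_).trans
      (mul_le_mul_of_nonneg_right (measureUnivNNReal_rpow_le ht) (norm_nonneg f))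
    filter_upwards [(memLp_IccExtend ht f).coeFn_toLp] with s hs
    change ‖(memLp_IccExtend ht f).toLp _ s‖ ≤ _
    rw [hs]
    exact f.norm_coe_le_norm _

lemma norm_inclL2_le (ht : 0 ≤ t) : ‖(inclL2 ht : Curve t d →L[ℝ] L2 t d)‖ ≤ 1 + t :=
  LinearMap.mkContinuous_norm_le _ (by linarith) _

lemma coeFn_inclL2 (ht : 0 ≤ t) (f : Curve t d) :
    inclL2 ht f =ᵐ[volume.restrict (Ioc 0 t)] IccExtend ht f :=
  (memLp_IccExtend ht f).coeFn_toLp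

lemma ae_restrict_mem_Icc : ∀ᵐ s ∂(volume.restrict (Ioc 0 t)), s ∈ Icc 0 t := by
  filter_upwards [ae_restrict_mem measurableSet_Ioc] with s hs
  exact Ioc_subset_Icc_self hs

lemma inclL2_ae_eq (ht : 0 ≤ t) (f : Curve t d) :
    ∀ᵐ s ∂(volume.restrict (Ioc 0 t)), ∀ hs : s ∈ Icc 0 t, inclL2 ht f s = f ⟨s, hs⟩ := by
  filter_upwards [coeFn_inclL2 ht f] with s h hs
  rw [h, IccExtend_of_mem _ _ hs]

lemma integrableOn_L2 (g : L2 t d) : IntegrableOn g (Ioc 0 t) :=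
  (Lp.memLp g).integrable (by norm_num)

lemma integral_norm_L2_le (ht : 0 ≤ t) (g : L2 t d) :
    ∫ s in Ioc 0 t, ‖g s‖ ≤ (1 + t) * ‖g‖ := by
  have hm := (Lp.memLp g).1
  have h1 := eLpNorm_le_eLpNorm_mul_rpow_measure_univ (p := 1) (q := 2) (by norm_num) hm
  have h2 : ((volume : Measure ℝ).restrict (Ioc 0 t)) univ ^
      (1 / ENNReal.toReal 1 - 1 / ENNReal.toReal 2) ≠ ⊤ := by
    refine ENNReal.rpow_ne_top_of_nonneg (by norm_num) (measure_ne_top _ _)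
  have h3 := ENNReal.toReal_mono (ENNReal.mul_ne_top (Lp.eLpNorm_ne_top g) h2) h1
  rw [ENNReal.toReal_mul, eLpNorm_one_eq_lintegral_enorm, ← integral_norm_eq_lintegral_enorm hm,
    ← Lp.norm_def] at h3
  refine h3.trans ?_
  rw [mul_comm]
  refine mul_le_mul_of_nonneg_right ?_ (norm_nonneg _)
  refine le_trans (le_of_eq ?_) (measureUnivNNReal_rpow_le ht)
  rw [← ENNReal.toReal_rpow]
  congr 1
  norm_num

lemma norm_integral_Ioc_L2_le (ht : 0 ≤ t) (g : L2 t d) {s : ℝ} (hs : 0 ≤ s) :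
    ‖∫ r in Ioc s t, g r‖ ≤ (1 + t) * ‖g‖ := by
  refine (norm_integral_le_integral_norm _).trans (le_trans ?_ (integral_norm_L2_le ht g))
  exact setIntegral_mono_set (integrableOn_L2 g).norm
    (Filter.Eventually.of_forall fun _ => norm_nonneg _)
    (Ioc_subset_Ioc_left hs).eventuallyLE

lemma continuous_integral_Ioc (ht : 0 ≤ t) (g : L2 t d) :
    Continuous fun s : Icc (0 : ℝ) t => -∫ r in Ioc (s : ℝ) t, g r := by
  have h := intervalIntegral.continuousOn_primitive_interval_left (a := 0) (b := t)
    (f := (g : ℝ → E d)) (μ := volume)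
    (by rw [uIcc_of_le ht, integrableOn_Icc_iff_integrableOn_Ioc]; exact integrableOn_L2 g)
  rw [uIcc_of_le ht, continuousOn_iff_continuous_domRestrict] at h
  refine (h.congr fun s => ?_).neg
  exact intervalIntegral.integral_of_le s.2.2

/-- The primitive `s ↦ -∫ₛᵗ g` of `g ∈ L²(0,t;ℝ^d)`. -/
def primitive (ht : 0 ≤ t) : L2 t d →L[ℝ] Curve t d :=
  LinearMap.mkContinuous
    { toFun := fun g => Curve.mk (fun s => -∫ r in Ioc (s : ℝ) t, g r) (continuous_integral_Ioc ht g)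
      map_add' := fun f g => by
        ext1 s
        have hsub : Ioc (s : ℝ) t ⊆ Ioc 0 t := Ioc_subset_Ioc_left s.2.1
        have h := ae_restrict_of_ae_restrict_of_subset hsub (Lp.coeFn_add f g)
        change -∫ r in Ioc (s : ℝ) t, (f + g : L2 t d) r
          = -(∫ r in Ioc (s : ℝ) t, f r) + -∫ r in Ioc (s : ℝ) t, g r
        rw [integral_congr_ae h, ← neg_add, ← integral_add ((integrableOn_L2 f).mono_set hsub)
          ((integrableOn_L2 g).mono_set hsub)]
        rfl
      map_smul' := fun c g => by
        ext1 s
        have hsub : Ioc (s : ℝ) t ⊆ Ioc 0 t := Ioc_subset_Ioc_left s.2.1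
        have h := ae_restrict_of_ae_restrict_of_subset hsub (Lp.coeFn_smul c g)
        change -∫ r in Ioc (s : ℝ) t, (c • g : L2 t d) r = c • -∫ r in Ioc (s : ℝ) t, g r
        rw [integral_congr_ae h, smul_neg, ← integral_smul]
        rfl } (1 + t) fun g => by
    rw [Curve.norm_le (mul_nonneg (by linarith) (norm_nonneg g))]
    intro s
    change ‖-∫ r in Ioc (s : ℝ) t, g r‖ ≤ _
    rw [norm_neg]
    exact norm_integral_Ioc_L2_le ht g s.2.1

lemma norm_primitive_le (ht : 0 ≤ t) :
    ‖(primitive ht : L2 t d →L[ℝ] Curve t d)‖ ≤ 1 + t :=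
  LinearMap.mkContinuous_norm_le _ (by linarith) _

lemma primitive_apply (ht : 0 ≤ t) (g : L2 t d) (s : Icc (0 : ℝ) t) :
    primitive ht g s = -∫ r in Ioc (s : ℝ) t, g r := rfl

variable (d t) in
/-- The constant functions on `[0,t]`. -/
def constC : E d →L[ℝ] Curve t d :=
  LinearMap.mkContinuous
    { toFun := fun ξ => Curve.mk (fun _ => ξ) continuous_const
      map_add' := fun _ _ => rfl
      map_smul' := fun _ _ => rfl } 1 fun ξ => by
    rw [one_mul, Curve.norm_le (norm_nonneg ξ)]
    exact fun _ => le_rfl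

lemma constC_apply (ξ : E d) (s : Icc (0 : ℝ) t) : constC d t ξ s = ξ := rfl

lemma norm_constC_le : ‖constC d t‖ ≤ 1 := LinearMap.mkContinuous_norm_le _ zero_le_one _

/-- The absolutely continuous function with terminal value `ξ` and derivative `g`. -/
def trajectory (ht : 0 ≤ t) : E d × L2 t d →L[ℝ] Curve t d :=
  (constC d t).comp (ContinuousLinearMap.fst ℝ _ _)
    + (primitive ht).comp (ContinuousLinearMap.snd ℝ _ _)

lemma trajectory_apply (ht : 0 ≤ t) (p : E d × L2 t d) :
    trajectory ht p = constC d t p.1 + primitive ht p.2 := rfl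

lemma integral_deriv_testFunction (ht : 0 ≤ t) {φ : ℝ → ℝ} (hφ : ContDiff ℝ ∞ φ)
    (hs : tsupport φ ⊆ Ioo 0 t) : φ 0 = 0 ∧ ∫ s in Ioc 0 t, deriv φ s = 0 := by
  have h0 : φ 0 = 0 := image_eq_zero_of_notMem_tsupport fun h => lt_irrefl _ (hs h).1
  have h1 : φ t = 0 := image_eq_zero_of_notMem_tsupport fun h => lt_irrefl _ (hs h).2
  refine ⟨h0, ?_⟩
  rw [← intervalIntegral.integral_of_le ht,
    intervalIntegral.integral_deriv_eq_sub (fun x _ => (hφ.differentiable (by simp)) x)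
      ((hφ.continuous_deriv (by simp)).intervalIntegrable _ _), h0, h1, sub_zero]

lemma hasWeakDeriv_trajectory (ht : 0 ≤ t) (p : E d × L2 t d) :
    HasWeakDeriv t (inclL2 ht (trajectory ht p)) p.2 := by
  intro φ hφ hc hs
  obtain ⟨h0, h1⟩ := integral_deriv_testFunction ht hφ hs
  have hφ' : Continuous (deriv φ) := hφ.continuous_deriv (by simp)
  have e : ∀ᵐ s ∂(volume.restrict (Ioc 0 t)), deriv φ s • inclL2 ht (trajectory ht p) s
      = deriv φ s • p.1 - deriv φ s • ∫ r in Ioc s t, p.2 r := by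
    filter_upwards [inclL2_ae_eq ht (trajectory ht p), ae_restrict_mem_Icc] with s h hs
    rw [h hs, trajectory_apply, Curve.add_apply, primitive_apply, constC_apply, smul_add,
      smul_neg, sub_eq_add_neg]
  have i1 : Integrable (fun s => deriv φ s • p.1) (volume.restrict (Ioc 0 t)) :=
    ((hφ'.integrableOn_Icc (a := 0) (b := t)).mono_set Ioc_subset_Icc_self).smul_const _
  have i2 : Integrable (fun s => deriv φ s • inclL2 ht (trajectory ht p) s)
      (volume.restrict (Ioc 0 t)) := integrable_smul_L2 hφ' hc.deriv _
  have i3 : Integrable (fun s => deriv φ s • ∫ r in Ioc s t, p.2 r)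
      (volume.restrict (Ioc 0 t)) := by
    refine (i1.sub i2).congr ?_
    filter_upwards [e] with s hs
    rw [Pi.sub_apply, hs, sub_sub_cancel]
  rw [integral_congr_ae e, integral_sub i1 i3, integral_smul_const, h1, zero_smul, zero_sub,
    integral_deriv_smul_integral_Ioc (integrableOn_L2 p.2) hφ h0]

/-- The element of `V_t` with terminal value `ξ` and weak derivative `g`. -/
def liftV (ht : 0 ≤ t) : E d × L2 t d →L[ℝ] V t d :=
  ((((WithLp.prodContinuousLinearEquiv 2 ℝ (L2 t d) (L2 t d)).symm :
      (L2 t d × L2 t d) →L[ℝ] WithLp 2 (L2 t d × L2 t d)).comp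
      (((inclL2 ht).comp (trajectory ht)).prod (ContinuousLinearMap.snd ℝ _ _))).prod
    ((Curve.toContinuousMap d t).comp (trajectory ht))).codRestrict (V t d) fun p =>
      ⟨inclL2_ae_eq ht _, hasWeakDeriv_trajectory ht p⟩

lemma curve_liftV (ht : 0 ≤ t) (p : E d × L2 t d) : V.curve (liftV ht p) = trajectory ht p := rfl

lemma dot_liftV (ht : 0 ≤ t) (p : E d × L2 t d) : V.dot (liftV ht p) = p.2 := rfl

lemma V.val_of_mem (x : V t d) {s : ℝ} (hs : s ∈ Icc 0 t) : V.val x s = V.curve x ⟨s, hs⟩ :=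
  dif_pos hs

lemma V.fst_eq_inclL2 (ht : 0 ≤ t) (x : V t d) : x.1.1.fst = inclL2 ht (V.curve x) := by
  refine Lp.ext ?_
  filter_upwards [x.2.1, inclL2_ae_eq ht (V.curve x), ae_restrict_mem_Icc] with s h1 h2 hs
  rw [h1 hs, h2 hs]
  rfl

lemma V.ext_of_curve_of_dot (ht : 0 ≤ t) {x y : V t d} (h1 : V.curve x = V.curve y)
    (h2 : V.dot x = V.dot y) : x = y := by
  refine Subtype.ext (Prod.ext ?_ h1)
  refine (WithLp.prodContinuousLinearEquiv 2 ℝ (L2 t d) (L2 t d)).injective ?_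
  refine Prod.ext ?_ h2
  change x.1.1.fst = y.1.1.fst
  rw [V.fst_eq_inclL2 ht, V.fst_eq_inclL2 ht, h1]

/-- The fundamental theorem of calculus in `V_t`. -/
lemma V.curve_eq_trajectory (ht : 0 < t) (x : V t d) :
    V.curve x = trajectory ht.le (V.curve x ⟨t, right_mem_Icc.2 ht.le⟩, V.dot x) := by
  set ξ := V.curve x ⟨t, right_mem_Icc.2 ht.le⟩ with hξ
  -- This difference has zero weak derivative and vanishes at `t`; du Bois-Reymond makes it
  -- constant, hence zero.
  set z : V t d := x - liftV ht.le (ξ, V.dot x) with hz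
  have hz2 : z.1.1.snd = 0 := sub_self (V.dot x)
  have hzc : V.curve z = V.curve x - trajectory ht.le (ξ, V.dot x) := rfl
  obtain ⟨c, hc⟩ := exists_const_of_integral_deriv_smul_eq_zero ht
    (h := IccExtend ht.le (V.curve z)) (V.curve z).continuous.Icc_extend' (by
      intro ψ hψ hψc hψs
      have h := z.2.2 ψ hψ hψc hψs
      rw [hz2] at h
      have e0 : ∫ s in Ioc 0 t, ψ s • (0 : L2 t d) s = 0 := by
        refine integral_eq_zero_of_ae ?_
        filter_upwards [Lp.coeFn_zero (E d) 2 (volume.restrict (Ioc 0 t))] with s hs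
        rw [hs]
        exact smul_zero _
      rw [e0, neg_zero] at h
      rw [← h]
      refine integral_congr_ae ?_
      filter_upwards [z.2.1, ae_restrict_mem_Icc] with s h1 hs
      rw [h1 hs, IccExtend_of_mem _ _ hs]
      rfl)
  have hzt : V.curve z ⟨t, right_mem_Icc.2 ht.le⟩ = 0 := by
    rw [hzc, Curve.sub_apply, trajectory_apply, Curve.add_apply, constC_apply,
      primitive_apply]
    simp [hξ]
  have hc0 : c = 0 := by
    rw [← hc t (right_mem_Icc.2 ht.le), IccExtend_of_mem _ _ (right_mem_Icc.2 ht.le), hzt]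
  rw [← sub_eq_zero, ← hzc]
  ext1 s
  have h := hc s s.2
  rw [IccExtend_of_mem _ _ s.2, hc0] at h
  exact h

end Operators

/-! ### Neumann series and Volterra operators -/

section Neumann

variable {X : Type*} [NormedAddCommGroup X] [NormedSpace ℝ X]

/-- The Neumann series `∑ Kⁱ`. -/
def neumannSeries (K : X →L[ℝ] X) : X →L[ℝ] X := ∑' i : ℕ, K ^ i

variable {K : X →L[ℝ] X} {c : ℝ}

lemma norm_neumannSeries_le (hK : ∀ k : ℕ, ‖K ^ k‖ ≤ c ^ k / k.factorial) :
    ‖neumannSeries K‖ ≤ Real.exp c := by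
  rw [Real.exp_eq_exp_ℝ]
  exact tsum_of_norm_bounded (NormedSpace.expSeries_div_hasSum_exp c) hK

lemma eq_add_iff_eq_neumannSeries [CompleteSpace X]
    (hK : ∀ k : ℕ, ‖K ^ k‖ ≤ c ^ k / k.factorial) (y z : X) :
    y = z + K y ↔ y = neumannSeries K z := by
  have hs : Summable (K ^ · : ℕ → X →L[ℝ] X) :=
    .of_norm_bounded (Real.summable_pow_div_factorial c) hK
  constructor
  · intro h
    have h1 : (1 - K) y = z := by
      change y - K y = z
      exact sub_eq_iff_eq_add.2 h
    rw [← h1]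
    exact (DFunLike.congr_fun hs.tsum_pow_mul_one_sub y).symm
  · intro h
    have h1 : (1 - K) (neumannSeries K z) = z :=
      DFunLike.congr_fun hs.one_sub_mul_tsum_pow z
    rw [← h] at h1
    exact sub_eq_iff_eq_add.1 h1

end Neumann

section Volterra

variable {d : ℕ} {t : ℝ}

/-- The Volterra operator `y ↦ (s ↦ -∫ₛᵗ (Q y)(r) dr)`. -/
def volterra (ht : 0 ≤ t) (Q : Curve t d →L[ℝ] Curve t d) :
    Curve t d →L[ℝ] Curve t d :=
  ((primitive ht).comp (inclL2 ht)).comp Q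

lemma norm_primitive_inclL2_apply_le (ht : 0 ≤ t) {f : Curve t d} {b : ℝ → ℝ}
    (hb : Continuous b) (hf : ∀ s : Icc 0 t, ‖f s‖ ≤ b s) (s : Icc 0 t) :
    ‖primitive ht (inclL2 ht f) s‖ ≤ ∫ r in (s : ℝ)..t, b r := by
  have hsub : Ioc (s : ℝ) t ⊆ Ioc 0 t := Ioc_subset_Ioc_left s.2.1
  rw [primitive_apply, norm_neg, intervalIntegral.integral_of_le s.2.2]
  refine norm_integral_le_of_norm_le (hb.integrableOn_Icc.mono_set Ioc_subset_Icc_self) ?_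
  filter_upwards [ae_restrict_of_ae_restrict_of_subset hsub (inclL2_ae_eq ht f),
    ae_restrict_of_ae_restrict_of_subset hsub ae_restrict_mem_Icc] with r h hr
  rw [h hr]
  exact hf ⟨r, hr⟩

/-- Since `Q` is bounded pointwise in `s`, each iteration integrates a power of `t - s` once more.
The resulting factorial makes the Neumann series converge without smallness of `L` or `t`. -/
lemma norm_volterra_pow_apply_le (ht : 0 ≤ t) {Q : Curve t d →L[ℝ] Curve t d}
    {L : ℝ} (hL : 0 ≤ L) (hQ : ∀ y s, ‖Q y s‖ ≤ L * ‖y s‖) (y : Curve t d) (k : ℕ) :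
    ∀ s : Icc 0 t, ‖(volterra ht Q ^ k) y s‖ ≤ (L * (t - s)) ^ k / k.factorial * ‖y‖ := by
  induction k with
  | zero =>
    intro s
    simpa using y.norm_coe_le_norm s
  | succ k ih =>
    intro s
    have e : (volterra ht Q ^ (k + 1)) y = primitive ht (inclL2 ht (Q ((volterra ht Q ^ k) y))) := by
      rw [pow_succ']
      rfl
    rw [e]
    refine (norm_primitive_inclL2_apply_le ht
      (b := fun r => L * ((L * (t - r)) ^ k / k.factorial * ‖y‖)) (by fun_prop)
      (fun r => (hQ _ r).trans (mul_le_mul_of_nonneg_left (ih r) hL)) s).trans (le_of_eq ?_)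
    have e2 : ∀ r : ℝ, L * ((L * (t - r)) ^ k / k.factorial * ‖y‖)
        = L ^ (k + 1) / k.factorial * ‖y‖ * (t - r) ^ k := by
      intro r
      rw [mul_pow]
      ring
    simp only [e2]
    rw [intervalIntegral.integral_const_mul,
      intervalIntegral.integral_comp_sub_left (fun x => x ^ k) t, integral_pow, sub_self,
      Nat.factorial_succ, mul_pow]
    push_cast
    field_simp
    simp

lemma norm_volterra_pow_le (ht : 0 ≤ t) {Q : Curve t d →L[ℝ] Curve t d}
    {L : ℝ} (hL : 0 ≤ L) (hQ : ∀ y s, ‖Q y s‖ ≤ L * ‖y s‖) (k : ℕ) :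
    ‖volterra ht Q ^ k‖ ≤ (L * t) ^ k / k.factorial := by
  refine ContinuousLinearMap.opNorm_le_bound _ (by positivity) fun y => ?_
  rw [Curve.norm_le (by positivity)]
  intro s
  refine (norm_volterra_pow_apply_le ht hL hQ y k s).trans ?_
  have h1 : 0 ≤ L * (t - s) := mul_nonneg hL (sub_nonneg.2 s.2.2)
  have h2 : L * (t - s) ≤ L * t := mul_le_mul_of_nonneg_left (by linarith [s.2.1]) hL
  gcongr

/-- The resolvent `(1 - K)⁻¹` of a Volterra operator `K`. -/
def resolvent (ht : 0 ≤ t) (Q : Curve t d →L[ℝ] Curve t d) : Curve t d →L[ℝ] Curve t d :=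
  neumannSeries (volterra ht Q)

lemma norm_resolvent_le (ht : 0 ≤ t) {Q : Curve t d →L[ℝ] Curve t d}
    {L : ℝ} (hL : 0 ≤ L) (hQ : ∀ y s, ‖Q y s‖ ≤ L * ‖y s‖) :
    ‖resolvent ht Q‖ ≤ Real.exp (L * t) :=
  norm_neumannSeries_le (norm_volterra_pow_le ht hL hQ)

lemma eq_add_volterra_iff (ht : 0 ≤ t) {Q : Curve t d →L[ℝ] Curve t d}
    {L : ℝ} (hL : 0 ≤ L) (hQ : ∀ y s, ‖Q y s‖ ≤ L * ‖y s‖) (y z : Curve t d) :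
    y = z + volterra ht Q y ↔ y = resolvent ht Q z :=
  eq_add_iff_eq_neumannSeries (norm_volterra_pow_le ht hL hQ) y z

lemma eq_zero_of_eq_volterra (ht : 0 ≤ t) {Q : Curve t d →L[ℝ] Curve t d}
    {L : ℝ} (hL : 0 ≤ L) (hQ : ∀ y s, ‖Q y s‖ ≤ L * ‖y s‖) {y : Curve t d}
    (h : y = volterra ht Q y) : y = 0 := by
  have := (eq_add_volterra_iff ht hL hQ y 0).1 (by rw [zero_add]; exact h)
  rwa [map_zero] at this

end Volterra

/-! ### The control-to-state equation for the deviation -/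

section PointwiseOperators

variable {a b d : ℕ} {t : ℝ}

variable (t) in
/-- The map `y ↦ (s ↦ L(y(s)))` on curves. -/
def mapC (L : E a →L[ℝ] E b) : Curve t a →L[ℝ] Curve t b :=
  LinearMap.mkContinuous
    { toFun := fun y => Curve.mk (fun s => L (y s)) (by fun_prop)
      map_add' := fun y z => by ext1 s; simp
      map_smul' := fun c y => by ext1 s; simp } ‖L‖ fun y => by
    rw [Curve.norm_le (by positivity)]
    exact fun s => L.le_opNorm_of_le (y.norm_coe_le_norm s)

lemma norm_mapC_le (L : E a →L[ℝ] E b) : ‖mapC t L‖ ≤ ‖L‖ :=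
  LinearMap.mkContinuous_norm_le _ (norm_nonneg _) _

variable (t) in
/-- The bilinear map `(y, z) ↦ (s ↦ G(y(s), z(s)))` on `C([0,t];ℝ^d)`. -/
def bilinC (G : E d →L[ℝ] E d →L[ℝ] E d) :
    Curve t d →L[ℝ] Curve t d →L[ℝ] Curve t d :=
  (LinearMap.mk₂ ℝ (fun y z : Curve t d =>
      Curve.mk (fun s => G (y s) (z s)) (by fun_prop))
    (fun y y' z => by ext1 s; simp) (fun c y z => by ext1 s; simp)
    (fun y z z' => by ext1 s; simp) (fun c y z => by ext1 s; simp)).mkContinuous₂ ‖G‖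
    fun y z => by
      rw [Curve.norm_le (by positivity)]
      exact fun s => G.le_of_opNorm₂_le_of_le le_rfl (y.norm_coe_le_norm s) (z.norm_coe_le_norm s)

lemma norm_bilinC_le (G : E d →L[ℝ] E d →L[ℝ] E d) : ‖bilinC t G‖ ≤ ‖G‖ :=
  LinearMap.mkContinuous₂_norm_le _ (norm_nonneg G) _

end PointwiseOperators

section QuadraticVolterra

variable {d a : ℕ} {t : ℝ}

/-- The linearization `y ↦ A y + G(x, y) + G(y, x)` of the vector field `A x + G(x, x)`. -/
def linField (A : E d →L[ℝ] E d) (G : E d →L[ℝ] E d →L[ℝ] E d) (x : Curve t d) :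
    Curve t d →L[ℝ] Curve t d :=
  mapC t A + bilinC t G x + (bilinC t G).flip x

lemma linField_apply (A : E d →L[ℝ] E d) (G : E d →L[ℝ] E d →L[ℝ] E d) (x y : Curve t d) :
    linField A G x y =
      mapC t A y + bilinC t G x y + bilinC t G y x := rfl

lemma norm_linField_apply_le (A : E d →L[ℝ] E d) (G : E d →L[ℝ] E d →L[ℝ] E d)
    {x : Curve t d} {N : ℝ} (hx : ‖x‖ ≤ N) (y : Curve t d) (s : Icc 0 t) :
    ‖linField A G x y s‖ ≤ (‖A‖ + 2 * ‖G‖ * N) * ‖y s‖ := by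
  have h1 : linField A G x y s = A (y s) + G (x s) (y s) + G (y s) (x s) := rfl
  have hxs : ‖x s‖ ≤ N := (x.norm_coe_le_norm s).trans hx
  rw [h1]
  calc ‖A (y s) + G (x s) (y s) + G (y s) (x s)‖
      ≤ ‖A‖ * ‖y s‖ + ‖G‖ * N * ‖y s‖ + ‖G‖ * ‖y s‖ * N :=
        norm_add_le_of_le (norm_add_le_of_le (A.le_opNorm _)
          (G.le_of_opNorm₂_le_of_le le_rfl hxs le_rfl)) (G.le_of_opNorm₂_le_of_le le_rfl le_rfl hxs)
    _ = _ := by ring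

/-- The linear part of the control-to-state equation. -/
def ctrlLin (ht : 0 ≤ t) (A : E d →L[ℝ] E d) (G : E d →L[ℝ] E d →L[ℝ] E d) (F : E a →L[ℝ] E d)
    (x : Curve t d) : E d × L2 t a →L[ℝ] Curve t d :=
  (resolvent ht (linField A G x)).comp ((trajectory ht).comp
    ((ContinuousLinearMap.id ℝ (E d)).prodMap (F.compLpL 2 (volume.restrict (Ioc 0 t)))))

/-- The quadratic part of the control-to-state equation. -/
def ctrlQuad (ht : 0 ≤ t) (A : E d →L[ℝ] E d) (G : E d →L[ℝ] E d →L[ℝ] E d)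
    (x : Curve t d) : Curve t d →L[ℝ] Curve t d →L[ℝ] Curve t d :=
  (ContinuousLinearMap.compL ℝ _ _ _ ((resolvent ht (linField A G x)).comp
    ((primitive ht).comp (inclL2 ht)))).comp (bilinC t G)

variable {A : E d →L[ℝ] E d} {G : E d →L[ℝ] E d →L[ℝ] E d} {F : E a →L[ℝ] E d}
  {x : Curve t d} {N T : ℝ}

lemma norm_resolvent_linField_le (ht : 0 ≤ t) (htT : t ≤ T) (hx : ‖x‖ ≤ N) :
    ‖resolvent ht (linField A G x)‖ ≤ Real.exp ((‖A‖ + 2 * ‖G‖ * N) * T) := by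
  have hN : 0 ≤ N := (norm_nonneg _).trans hx
  refine (norm_resolvent_le ht (by positivity) (norm_linField_apply_le A G hx)).trans ?_
  gcongr

lemma norm_ctrlLin_le (ht : 0 ≤ t) (htT : t ≤ T) (hx : ‖x‖ ≤ N) :
    ‖ctrlLin ht A G F x‖ ≤ Real.exp ((‖A‖ + 2 * ‖G‖ * N) * T) * (1 + (1 + T) * ‖F‖) := by
  refine (ContinuousLinearMap.opNorm_comp_le _ _).trans ?_
  have h2 : ‖(trajectory ht).comp ((ContinuousLinearMap.id ℝ (E d)).prodMap
      (F.compLpL 2 (volume.restrict (Ioc 0 t))))‖ ≤ 1 + (1 + T) * ‖F‖ := by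
    have hT : 0 ≤ 1 + T := by linarith
    refine ContinuousLinearMap.opNorm_le_bound _ (by positivity) fun p => ?_
    have e : ((trajectory ht).comp ((ContinuousLinearMap.id ℝ (E d)).prodMap
      (F.compLpL 2 (volume.restrict (Ioc 0 t))))) p = constC d t p.1 +
        primitive ht (F.compLpL 2 (volume.restrict (Ioc 0 t)) p.2) := rfl
    rw [e, add_mul]
    refine norm_add_le_of_le ?_ ?_
    · exact ContinuousLinearMap.le_of_opNorm_le_of_le _ norm_constC_le (norm_fst_le p)
    · rw [mul_assoc]
      refine ContinuousLinearMap.le_of_opNorm_le_of_le _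
        ((norm_primitive_le ht).trans (by linarith)) ?_
      exact ContinuousLinearMap.le_of_opNorm_le_of_le _ (F.norm_compLpL_le) (norm_snd_le p)
  have := norm_resolvent_linField_le (A := A) (G := G) ht htT hx
  gcongr

lemma norm_ctrlQuad_le (ht : 0 ≤ t) (htT : t ≤ T) (hx : ‖x‖ ≤ N) :
    ‖ctrlQuad ht A G x‖ ≤ Real.exp ((‖A‖ + 2 * ‖G‖ * N) * T) * ((1 + T) * ((1 + T) * ‖G‖)) := by
  have h1 := norm_resolvent_linField_le (A := A) (G := G) ht htT hx
  have hT : 0 ≤ 1 + T := by linarith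
  refine ContinuousLinearMap.opNorm_le_bound₂ _ (by positivity) fun y z => ?_
  have e : ctrlQuad ht A G x y z =
    resolvent ht (linField A G x) (primitive ht (inclL2 ht (bilinC t G y z))) := rfl
  have e2 : Real.exp ((‖A‖ + 2 * ‖G‖ * N) * T) * ((1 + T) * ((1 + T) * ‖G‖)) * ‖y‖ * ‖z‖ =
    Real.exp ((‖A‖ + 2 * ‖G‖ * N) * T) * ((1 + T) * ((1 + T) * (‖G‖ * ‖y‖ * ‖z‖))) := by ring
  rw [e, e2]
  refine ContinuousLinearMap.le_of_opNorm_le_of_le _ h1 ?_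
  refine ContinuousLinearMap.le_of_opNorm_le_of_le _ ((norm_primitive_le ht).trans (by linarith)) ?_
  refine ContinuousLinearMap.le_of_opNorm_le_of_le _ ((norm_inclL2_le ht).trans (by linarith)) ?_
  exact (bilinC t G).le_of_opNorm₂_le_of_le (norm_bilinC_le G) le_rfl le_rfl

/-- The resolvent moves the linear term `linField A G x y` to the other side, turning the integral
equation into a purely quadratic fixed point equation. -/
lemma ctrl_eq_iff (ht : 0 ≤ t) (p : E d × L2 t a) (y : Curve t d) :
    y = ctrlLin ht A G F x p + ctrlQuad ht A G x y y ↔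
      y = trajectory ht (p.1, inclL2 ht (linField A G x y + bilinC t G y y)
        + F.compLpL 2 (volume.restrict (Ioc 0 t)) p.2) := by
  have h := eq_add_volterra_iff ht (by positivity) (norm_linField_apply_le A G (le_refl ‖x‖)) y
    (trajectory ht (p.1, F.compLpL 2 (volume.restrict (Ioc 0 t)) p.2)
      + primitive ht (inclL2 ht (bilinC t G y y)))
  have e1 : ctrlLin ht A G F x p + ctrlQuad ht A G x y y = resolvent ht (linField A G x)
      (trajectory ht (p.1, F.compLpL 2 (volume.restrict (Ioc 0 t)) p.2)
        + primitive ht (inclL2 ht (bilinC t G y y))) := by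
    rw [map_add]
    rfl
  have e2 : trajectory ht (p.1, inclL2 ht (linField A G x y + bilinC t G y y)
        + F.compLpL 2 (volume.restrict (Ioc 0 t)) p.2) =
      (trajectory ht (p.1, F.compLpL 2 (volume.restrict (Ioc 0 t)) p.2)
        + primitive ht (inclL2 ht (bilinC t G y y))) + volterra ht (linField A G x) y := by
    have e3 : volterra ht (linField A G x) y = primitive ht (inclL2 ht (linField A G x y)) := rfl
    simp only [trajectory_apply, map_add, e3]
    abel
  rw [e1, e2, h]

/-- As `G(y,y) - G(z,z) = G(y,y-z) + G(y-z,z)`, the difference solves a homogeneous linear Volterra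
equation with coefficients frozen at `y` and `z`. No smallness is needed. -/
lemma ctrl_unique (ht : 0 ≤ t) {η y z : Curve t d} (hy : y = η + ctrlQuad ht A G x y y)
    (hz : z = η + ctrlQuad ht A G x z z) : y = z := by
  have hL := norm_linField_apply_le A G (le_refl ‖x‖)
  have hsub : y - z = resolvent ht (linField A G x)
      (primitive ht (inclL2 ht (bilinC t G y y - bilinC t G z z))) := by
    have e : y - z = ctrlQuad ht A G x y y - ctrlQuad ht A G x z z := by
      conv_lhs => rw [hy, hz]
      abel
    rw [e, map_sub, map_sub, map_sub]
    rfl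
  rw [← eq_add_volterra_iff ht (by positivity) hL] at hsub
  set Q : Curve t d →L[ℝ] Curve t d :=
    linField A G x + (bilinC t G y + (bilinC t G).flip z) with hQ
  have hQe : y - z = volterra ht Q (y - z) := by
    have e : volterra ht Q (y - z) = primitive ht (inclL2 ht (bilinC t G y y - bilinC t G z z))
        + volterra ht (linField A G x) (y - z) := by
      have e1 : volterra ht Q (y - z) = primitive ht (inclL2 ht
        (linField A G x (y - z) + (bilinC t G y (y - z) + bilinC t G (y - z) z))) := rfl
      have e2 : bilinC t G y (y - z) + bilinC t G (y - z) z
          = bilinC t G y y - bilinC t G z z := (bilin_diag_sub _ _ _).symm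
      rw [e1, e2, map_add, map_add, add_comm]
      rfl
    rw [e]
    exact hsub
  refine sub_eq_zero.1 (eq_zero_of_eq_volterra ht (L := ‖A‖ + 2 * ‖G‖ * ‖x‖
    + (‖G‖ * ‖y‖ + ‖G‖ * ‖z‖)) (by positivity) (fun w s => ?_) hQe)
  have e : Q w s = linField A G x w s + (G (y s) (w s) + G (w s) (z s)) := rfl
  rw [e, add_mul]
  refine norm_add_le_of_le (hL w s) ?_
  rw [add_mul]
  refine norm_add_le_of_le
    (G.le_of_opNorm₂_le_of_le le_rfl (y.norm_coe_le_norm s) le_rfl) ?_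
  refine (G.le_of_opNorm₂_le_of_le le_rfl le_rfl (z.norm_coe_le_norm s)).trans (le_of_eq ?_)
  ring

end QuadraticVolterra

/-! ### Reduction of the optimal control problem to the abstract one -/

section Reduction

variable {n m r : ℕ}

/-- The matrix `A` as a continuous linear map. -/
def Data.opA (D : Data n m r) : E n →L[ℝ] E n := LinearMap.toContinuousLinearMap D.A.toEuclideanLin

/-- The matrix `F` as a continuous linear map. -/
def Data.opF (D : Data n m r) : E m →L[ℝ] E n := LinearMap.toContinuousLinearMap D.F.toEuclideanLin

/-- The matrix `C` as a continuous linear map. -/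
def Data.opC (D : Data n m r) : E n →L[ℝ] E r := LinearMap.toContinuousLinearMap D.C.toEuclideanLin

/-- The bilinear map `(x, y) ↦ G (x ⊗ y)`. -/
def Data.opG (D : Data n m r) : E n →L[ℝ] E n →L[ℝ] E n :=
  (LinearMap.mk₂ ℝ (fun x y => D.G.toEuclideanLin (kron x y))
    (fun x x' y => by
      rw [← map_add]
      congr 1
      ext p
      simp [kron, add_mul])
    (fun c x y => by
      rw [← map_smul]
      congr 1
      ext p
      simp [kron, mul_assoc])
    (fun x y y' => by
      rw [← map_add]
      congr 1
      ext p
      simp [kron, mul_add])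
    (fun c x y => by
      rw [← map_smul]
      congr 1
      ext p
      simp [kron, mul_left_comm])).toContinuousBilinearMap

/-- The vector field `A x + G (x ⊗ x)` along a curve. -/
def Data.field (D : Data n m r) {t : ℝ} (x : Curve t n) : Curve t n :=
  mapC t D.opA x + bilinC t D.opG x x

lemma Data.field_apply (D : Data n m r) {t : ℝ} (x : Curve t n) (s : Icc 0 t) :
    D.field x s = D.A.toEuclideanLin (x s) + D.G.toEuclideanLin (kron (x s) (x s)) := rfl

lemma Data.field_add (D : Data n m r) {t : ℝ} (x y : Curve t n) :
    D.field (x + y) = D.field x + (linField D.opA D.opG x y + bilinC t D.opG y y) := by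
  rw [linField_apply]
  simp only [Data.field, map_add, _root_.add_apply]
  abel

lemma Data.contDiff_field (D : Data n m r) {t : ℝ} :
    ContDiff ℝ ∞ (D.field : Curve t n → Curve t n) := by
  unfold Data.field
  fun_prop

/-- The action of the matrix `F` on controls. -/
def Data.ctrlF (D : Data n m r) (t : ℝ) : L2 t m →L[ℝ] L2 t n :=
  D.opF.compLpL 2 (volume.restrict (Ioc 0 t))

/-- The restriction of a curve on `[0,T]` to `[0,t]`. -/
def Curve.restrict {d : ℕ} {t T : ℝ} (htT : t ≤ T) (x : Curve T d) : Curve t d :=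
  Curve.mk (fun s => x ⟨s, s.2.1, s.2.2.trans htT⟩) (by fun_prop)

lemma Curve.norm_restrict_le {d : ℕ} {t T : ℝ} (htT : t ≤ T) (x : Curve T d) :
    ‖x.restrict htT‖ ≤ ‖x‖ := by
  rw [Curve.norm_le (norm_nonneg _)]
  exact fun s => x.norm_coe_le_norm _

variable {D : Data n m r} {T t : ℝ} {xt : V T n}

/-- Splitting the integral over `(s, T]` at `t` moves the anchor from `T` to `t`. -/
lemma nominal_eq_trajectory (ht : 0 < t) (htT : t ≤ T) (hxt : IsNominal D T xt) :
    (V.curve xt).restrict htT = trajectory ht.le (V.curve xt ⟨t, ht.le, htT⟩,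
      inclL2 ht.le (D.field ((V.curve xt).restrict htT))) := by
  have hT : 0 < T := ht.trans_le htT
  have hint := integrableOn_L2 (V.dot xt)
  have hval : ∀ s : Icc 0 T, V.curve xt s =
      V.curve xt ⟨T, right_mem_Icc.2 hT.le⟩ - ∫ r in Ioc (s : ℝ) T, V.dot xt r := by
    intro s
    conv_lhs => rw [V.curve_eq_trajectory hT xt]
    rw [trajectory_apply, Curve.add_apply, constC_apply, primitive_apply, sub_eq_add_neg]
  ext1 s
  have hst : (s : ℝ) ≤ t := s.2.2
  have hsplit : ∫ r in Ioc (s : ℝ) T, V.dot xt r =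
      (∫ r in Ioc (s : ℝ) t, V.dot xt r) + ∫ r in Ioc t T, V.dot xt r := by
    rw [← Ioc_union_Ioc_eq_Ioc hst htT]
    refine setIntegral_union (Ioc_disjoint_Ioc_of_le le_rfl) measurableSet_Ioc
      (hint.mono_set (Ioc_subset_Ioc s.2.1 htT)) (hint.mono_set (Ioc_subset_Ioc_left ht.le))
  have hfield : ∫ r in Ioc (s : ℝ) t, V.dot xt r =
      ∫ r in Ioc (s : ℝ) t, inclL2 ht.le (D.field ((V.curve xt).restrict htT)) r := by
    refine integral_congr_ae ?_
    have hsub : Ioc (s : ℝ) t ⊆ Ioc 0 t := Ioc_subset_Ioc_left s.2.1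
    filter_upwards [ae_restrict_of_ae_restrict_of_subset
      (hsub.trans (Ioc_subset_Ioc_right htT)) hxt.1,
      ae_restrict_of_ae_restrict_of_subset hsub (inclL2_ae_eq ht.le _),
      ae_restrict_of_ae_restrict_of_subset hsub ae_restrict_mem_Icc] with r h1 h2 hr
    rw [h1, h2 hr, Data.field_apply, V.val_of_mem xt ⟨hr.1, hr.2.trans htT⟩]
    rfl
  have e1 : (V.curve xt).restrict htT s =
      V.curve xt ⟨T, right_mem_Icc.2 hT.le⟩ - ∫ r in Ioc (s : ℝ) T, V.dot xt r :=
    hval ⟨s, s.2.1, hst.trans htT⟩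
  have e2 : V.curve xt ⟨t, ht.le, htT⟩ =
      V.curve xt ⟨T, right_mem_Icc.2 hT.le⟩ - ∫ r in Ioc t T, V.dot xt r := hval ⟨t, ht.le, htT⟩
  rw [trajectory_apply, Curve.add_apply, constC_apply, primitive_apply, e1, e2, hsplit, hfield]
  have e3 : ∀ u v w : E n, u - (v + w) = u - w + -v := fun u v w => by abel
  exact e3 _ _ _

lemma mem_feasible_iff (ht : 0 < t) (htT : t ≤ T) {ξ : E n} {q : V t n × L2 t m} :
    q ∈ feasible D xt t ξ ↔
      V.dot q.1 = inclL2 ht.le (D.field (V.curve q.1)) + D.ctrlF t q.2 ∧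
      V.curve q.1 ⟨t, right_mem_Icc.2 ht.le⟩ = V.curve xt ⟨t, ht.le, htT⟩ + ξ := by
  have h1 : V.val q.1 t = V.curve q.1 ⟨t, right_mem_Icc.2 ht.le⟩ :=
    V.val_of_mem q.1 (right_mem_Icc.2 ht.le)
  have h2 : V.val xt t = V.curve xt ⟨t, ht.le, htT⟩ := V.val_of_mem xt ⟨ht.le, htT⟩
  have h3 : ∀ᵐ s ∂(volume.restrict (Ioc (0 : ℝ) t)),
      (inclL2 ht.le (D.field (V.curve q.1)) + D.ctrlF t q.2 : L2 t n) s =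
        D.A.toEuclideanLin (V.val q.1 s) + D.G.toEuclideanLin (kron (V.val q.1 s) (V.val q.1 s))
          + D.F.toEuclideanLin (q.2 s) := by
    filter_upwards [Lp.coeFn_add (inclL2 ht.le (D.field (V.curve q.1))) (D.ctrlF t q.2),
      inclL2_ae_eq ht.le (D.field (V.curve q.1)), D.opF.coeFn_compLpL q.2,
      ae_restrict_mem_Icc] with s e1 e2 e3 hs
    rw [e1, Pi.add_apply, e2 hs, Data.field_apply, V.val_of_mem q.1 hs]
    exact congrArg _ e3
  unfold feasible
  rw [mem_ofPred_eq, h1, h2]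
  refine and_congr_left fun _ => ⟨fun h => Lp.ext ?_, fun h => ?_⟩
  · filter_upwards [h, h3] with s e1 e2
    rw [e1, e2]
  · filter_upwards [h3] with s e
    rw [h, e]

/-- The deviation from the nominal trajectory solves the control-to-state equation. -/
lemma ctrl_eq_of_mem_feasible (ht : 0 < t) (htT : t ≤ T) (hxt : IsNominal D T xt) {ξ : E n}
    {q : V t n × L2 t m} (hq : q ∈ feasible D xt t ξ) :
    V.curve q.1 - (V.curve xt).restrict htT =
      ctrlLin ht.le D.opA D.opG D.opF ((V.curve xt).restrict htT) (ξ, q.2)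
      + ctrlQuad ht.le D.opA D.opG ((V.curve xt).restrict htT)
        (V.curve q.1 - (V.curve xt).restrict htT) (V.curve q.1 - (V.curve xt).restrict htT) := by
  rw [ctrl_eq_iff]
  obtain ⟨h1, h2⟩ := (mem_feasible_iff ht htT).1 hq
  have h3 := V.curve_eq_trajectory ht q.1
  have h4 := nominal_eq_trajectory ht htT hxt
  have h5 := D.field_add ((V.curve xt).restrict htT)
    (V.curve q.1 - (V.curve xt).restrict htT)
  rw [add_sub_cancel] at h5
  -- Both curves are trajectories ending at `t`; by linearity their difference is one too, and the
  -- exact quadratic expansion of the field leaves the terms in the deviation.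
  conv_lhs => rw [h3, h4]
  rw [h1, h2, h5, ← map_sub, Prod.mk_sub_mk, add_sub_cancel_left, map_add]
  congr 2
  change _ = _ + D.ctrlF t q.2
  abel

/-- The state-control pair with deviation `y` from the nominal trajectory. -/
def toPair (D : Data n m r) (xt : V T n) (ht : 0 < t) (htT : t ≤ T) (ξ : E n)
    (z : Curve t n × L2 t m) : V t n × L2 t m :=
  (liftV ht.le (V.curve xt ⟨t, ht.le, htT⟩ + ξ,
    inclL2 ht.le (D.field ((V.curve xt).restrict htT + z.1)) + D.ctrlF t z.2), z.2)

lemma contDiff_toPair (ht : 0 < t) (htT : t ≤ T) :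
    ContDiff ℝ ∞ fun p : E n × (Curve t n × L2 t m) => toPair D xt ht htT p.1 p.2 := by
  unfold toPair
  have h := (D.contDiff_field (t := t)).comp
    (f := fun p : E n × (Curve t n × L2 t m) => (V.curve xt).restrict htT + p.2.1) (by fun_prop)
  have h' : ContDiff ℝ ∞ fun p : E n × (Curve t n × L2 t m) =>
      inclL2 ht.le (D.field ((V.curve xt).restrict htT + p.2.1)) := (inclL2 ht.le).contDiff.comp h
  fun_prop

/-- `toPair` prescribes the weak derivative, so its smoothness in the `V_t` norm needs no equation.
Only the state equation ensures that integrating this derivative gives back the curve it was built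
from. -/
lemma curve_toPair (ht : 0 < t) (htT : t ≤ T) (hxt : IsNominal D T xt) {ξ : E n}
    {z : Curve t n × L2 t m}
    (hz : z.1 = ctrlLin ht.le D.opA D.opG D.opF ((V.curve xt).restrict htT) (ξ, z.2)
      + ctrlQuad ht.le D.opA D.opG ((V.curve xt).restrict htT) z.1 z.1) :
    V.curve (toPair D xt ht htT ξ z).1 = (V.curve xt).restrict htT + z.1 := by
  rw [ctrl_eq_iff] at hz
  have h4 := nominal_eq_trajectory ht htT hxt
  refine Eq.trans ?_ (congrArg₂ HAdd.hAdd h4 hz).symm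
  rw [toPair, curve_liftV, D.field_add, ← map_add, Prod.mk_add_mk, map_add]
  congr 2
  change _ = _ + (_ + D.ctrlF t z.2)
  abel

lemma toPair_mem_feasible (ht : 0 < t) (htT : t ≤ T) (hxt : IsNominal D T xt) {ξ : E n}
    {z : Curve t n × L2 t m}
    (hz : z.1 = ctrlLin ht.le D.opA D.opG D.opF ((V.curve xt).restrict htT) (ξ, z.2)
      + ctrlQuad ht.le D.opA D.opG ((V.curve xt).restrict htT) z.1 z.1) :
    toPair D xt ht htT ξ z ∈ feasible D xt t ξ := by
  rw [mem_feasible_iff ht htT, curve_toPair ht htT hxt hz]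
  refine ⟨rfl, ?_⟩
  rw [← curve_toPair ht htT hxt hz, toPair, curve_liftV, trajectory_apply, Curve.add_apply,
    constC_apply, primitive_apply]
  simp

lemma eq_toPair_of_mem_feasible (ht : 0 < t) (htT : t ≤ T) (hxt : IsNominal D T xt) {ξ : E n}
    {q : V t n × L2 t m} (hq : q ∈ feasible D xt t ξ) :
    q = toPair D xt ht htT ξ (V.curve q.1 - (V.curve xt).restrict htT, q.2) := by
  have hc := curve_toPair ht htT hxt (z := (V.curve q.1 - (V.curve xt).restrict htT, q.2))
    (ctrl_eq_of_mem_feasible ht htT hxt hq)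
  rw [add_sub_cancel] at hc
  refine Prod.ext (V.ext_of_curve_of_dot ht.le hc.symm ?_) rfl
  rw [((mem_feasible_iff ht htT).1 hq).1, toPair, dot_liftV, add_sub_cancel]

lemma L2_norm_sq {d : ℕ} (f : L2 t d) :
    ‖f‖ ^ 2 = ∫ s in Ioc 0 t, ‖f s‖ ^ 2 := by
  rw [← real_inner_self_eq_norm_sq, L2.inner_def]
  simp only [real_inner_self_eq_norm_sq]

lemma L2_integrable_norm_sq {d : ℕ} (f : L2 t d) :
    Integrable (fun s => ‖f s‖ ^ 2) (volume.restrict (Ioc 0 t)) := by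
  simpa only [real_inner_self_eq_norm_sq] using L2.integrable_inner (𝕜 := ℝ) f f

/-- The observation operator `y ↦ C y`. -/
def Data.obs (D : Data n m r) (ht : 0 ≤ t) : Curve t n →L[ℝ] L2 t r :=
  (inclL2 ht).comp (mapC t D.opC)

/-- The measurement enters only through its class on `(0,t)`, so one statement serves measurements
on `(0,t)` and on `(0,T)`. -/
lemma J_eq_quadCost (ht : 0 < t) (htT : t ≤ T) (hxt : IsNominal D T xt) {w : ℝ → E r}
    {w₀ : L2 t r} (hw : w =ᵐ[volume.restrict (Ioc 0 t)] w₀) (q : V t n × L2 t m) :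
    J D xt t w q = quadCost (Curve.eval ⟨0, left_mem_Icc.2 ht.le⟩) (D.obs ht.le) D.α w₀
      (V.curve q.1 - (V.curve xt).restrict htT, q.2) := by
  have hT : 0 < T := ht.trans_le htT
  have h0 : V.val q.1 0 - D.x₀ = Curve.eval ⟨0, left_mem_Icc.2 ht.le⟩
      (V.curve q.1 - (V.curve xt).restrict htT) := by
    rw [← hxt.2, V.val_of_mem q.1 (left_mem_Icc.2 ht.le), V.val_of_mem xt (left_mem_Icc.2 hT.le)]
    rfl
  have h1 : ∫ s in (0 : ℝ)..t, (‖q.2 s‖ ^ 2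
        + D.α * ‖w s - D.C.toEuclideanLin (V.val q.1 s - V.val xt s)‖ ^ 2) =
      ∫ s in Ioc 0 t, (‖q.2 s‖ ^ 2 + D.α *
        ‖(w₀ - D.obs ht.le (V.curve q.1 - (V.curve xt).restrict htT) : L2 t r) s‖ ^ 2) := by
    rw [intervalIntegral.integral_of_le ht.le]
    refine integral_congr_ae ?_
    filter_upwards [hw, Lp.coeFn_sub w₀ (D.obs ht.le (V.curve q.1 - (V.curve xt).restrict htT)),
      inclL2_ae_eq ht.le (mapC t D.opC (V.curve q.1 - (V.curve xt).restrict htT)),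
      ae_restrict_mem_Icc] with s e1 e2 e3 hs
    rw [e1, e2, Pi.sub_apply, Data.obs, ContinuousLinearMap.comp_apply, e3 hs,
      V.val_of_mem q.1 hs, V.val_of_mem xt ⟨hs.1, hs.2.trans htT⟩]
    rfl
  rw [J, h0, h1, integral_add (L2_integrable_norm_sq _) ((L2_integrable_norm_sq _).const_mul _),
    integral_const_mul, ← L2_norm_sq, ← L2_norm_sq]
  rfl

end Reduction

/-! ### Uniform bounds, the smooth solution map and the value function -/

section Main

variable {n m r : ℕ}

/-- A common bound, uniform in `t ∈ (0,T]`, for all the operators of the reduced problem. -/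
def Data.bound (D : Data n m r) (T N : ℝ) : ℝ :=
  1 + D.α + Real.exp ((‖D.opA‖ + 2 * ‖D.opG‖ * N) * T) * (1 + (1 + T) * ‖D.opF‖)
    + Real.exp ((‖D.opA‖ + 2 * ‖D.opG‖ * N) * T) * ((1 + T) * ((1 + T) * ‖D.opG‖))
    + (1 + T) * ‖D.opC‖

/-- The restriction `L²(0,T;ℝ^d) → L²(0,t;ℝ^d)`. -/
def restrictL2 {d : ℕ} {t T : ℝ} (htT : t ≤ T) : L2 T d →L[ℝ] L2 t d :=
  Lp.LpToLpOfMeasureLeSMul (c := 1) ENNReal.one_ne_top (by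
    rw [one_smul]
    exact Measure.restrict_mono (Ioc_subset_Ioc_right htT) le_rfl)

lemma coeFn_restrictL2 {d : ℕ} {t T : ℝ} (htT : t ≤ T) (f : L2 T d) :
    restrictL2 htT f =ᵐ[volume.restrict (Ioc 0 t)] f :=
  Lp.coeFn_LpToLpOfMeasureLeSMul _ _ _

lemma norm_restrictL2_apply_le {d : ℕ} {t T : ℝ} (htT : t ≤ T) (f : L2 T d) :
    ‖restrictL2 htT f‖ ≤ ‖f‖ := by
  have h : ‖(restrictL2 htT : L2 T d →L[ℝ] L2 t d)‖ ≤ 1 := by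
    refine (Lp.norm_LpToLpOfMeasureLeSMul_le _ _).trans (le_of_eq ?_)
    simp
  simpa using ContinuousLinearMap.le_of_opNorm_le _ h f

lemma mapsTo_restrictL2_ball {d : ℕ} {t T : ℝ} (htT : t ≤ T) (δ : ℝ) :
    MapsTo (fun p : E n × L2 T d => (p.1, restrictL2 htT p.2)) (ball 0 δ)
      (ball (0 : E n × L2 t d) δ) := by
  intro p hp
  rw [mem_ball_zero_iff] at hp ⊢
  exact (max_le_max le_rfl (norm_restrictL2_apply_le htT p.2)).trans_lt hp

lemma contDiff_restrictL2 {d : ℕ} {t T : ℝ} (htT : t ≤ T) :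
    ContDiff ℝ ∞ fun p : E n × L2 T d => (p.1, (restrictL2 htT p.2 : L2 t d)) := by
  fun_prop

variable {D : Data n m r} {T t : ℝ} {xt : V T n}

theorem exists_smooth_deviation (hα : 0 < D.α) (ht : 0 < t) (htT : t ≤ T) :
    ∃ S : E n × L2 t r → Curve t n × L2 t m,
      ContDiffOn ℝ ∞ S (ball 0 (controlRadius (D.bound T ‖V.curve xt‖))) ∧
      ∀ p ∈ ball (0 : E n × L2 t r) (controlRadius (D.bound T ‖V.curve xt‖)),
        (S p).1 = ctrlLin ht.le D.opA D.opG D.opF ((V.curve xt).restrict htT) (p.1, (S p).2)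
          + ctrlQuad ht.le D.opA D.opG ((V.curve xt).restrict htT) (S p).1 (S p).1 ∧
        ∀ q : Curve t n × L2 t m,
          q.1 = ctrlLin ht.le D.opA D.opG D.opF ((V.curve xt).restrict htT) (p.1, q.2)
            + ctrlQuad ht.le D.opA D.opG ((V.curve xt).restrict htT) q.1 q.1 →
          quadCost (Curve.eval ⟨0, left_mem_Icc.2 ht.le⟩) (D.obs ht.le) D.α p.2 (S p) ≤
            quadCost (Curve.eval ⟨0, left_mem_Icc.2 ht.le⟩) (D.obs ht.le) D.α p.2 q ∧
          (quadCost (Curve.eval ⟨0, left_mem_Icc.2 ht.le⟩) (D.obs ht.le) D.α p.2 q ≤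
            quadCost (Curve.eval ⟨0, left_mem_Icc.2 ht.le⟩) (D.obs ht.le) D.α p.2 (S p) →
            q = S p) := by
  have hT : 0 < T := ht.trans_le htT
  have hx := Curve.norm_restrict_le htT (V.curve xt)
  set N := ‖V.curve xt‖ with hN
  have hobs : ‖D.obs ht.le‖ ≤ (1 + T) * ‖D.opC‖ :=
    (ContinuousLinearMap.opNorm_comp_le _ _).trans (mul_le_mul
      ((norm_inclL2_le ht.le).trans (by linarith)) (norm_mapC_le _) (norm_nonneg _) (by linarith))
  have h1 : 0 ≤ Real.exp ((‖D.opA‖ + 2 * ‖D.opG‖ * N) * T) * (1 + (1 + T) * ‖D.opF‖) := by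
    positivity
  have h2 : 0 ≤ Real.exp ((‖D.opA‖ + 2 * ‖D.opG‖ * N) * T) * ((1 + T) * ((1 + T) * ‖D.opG‖)) := by
    positivity
  have h3 : 0 ≤ (1 + T) * ‖D.opC‖ := by positivity
  have h4 : ‖ctrlLin ht.le D.opA D.opG D.opF ((V.curve xt).restrict htT)‖ ≤ _ :=
    norm_ctrlLin_le ht.le htT hx
  have h5 : ‖ctrlQuad ht.le D.opA D.opG ((V.curve xt).restrict htT)‖ ≤ _ :=
    norm_ctrlQuad_le ht.le htT hx
  have h6 := Curve.norm_eval_le (d := n) (⟨0, left_mem_Icc.2 ht.le⟩ : Icc 0 t)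
  unfold Data.bound
  exact exists_smooth_minimizer _ _ _ _ (by linarith) (h4.trans (by linarith))
    (h5.trans (by linarith)) (h6.trans (by linarith)) (hobs.trans (by linarith)) hα.le
    (by linarith) fun η y z hy hz => ctrl_unique ht.le hy hz

lemma bound_pos (hα : 0 < D.α) (hT : 0 < T) : 0 < D.bound T ‖V.curve xt‖ := by
  unfold Data.bound
  positivity

/-- The infimum is attained, so the default value of `sInf` on empty or unbounded sets plays no
role. -/
theorem value_eq_of_isSolution {ξ : E n} {w : ℝ → E r} {q : V t n × L2 t m}
    (hq : IsSolution D xt t ξ w q) : value D xt t ξ w = J D xt t w q :=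
  IsLeast.csInf_eq ⟨mem_image_of_mem _ hq.1, by
    rintro _ ⟨q', hq', rfl⟩
    exact hq.2 q' hq'⟩

/-- Unique and smooth solvability of the optimal control problem, together with smoothness of the
minimal cost, on a ball whose radius does not depend on `t`. -/
theorem exists_smooth_solution (hα : 0 < D.α) (hxt : IsNominal D T xt) (ht : 0 < t)
    (htT : t ≤ T) :
    ∃ (S : E n × L2 t r → V t n × L2 t m) (f : E n × L2 t r → ℝ),
      ContDiffOn ℝ ∞ S (ball 0 (controlRadius (D.bound T ‖V.curve xt‖))) ∧
      ContDiffOn ℝ ∞ f (ball 0 (controlRadius (D.bound T ‖V.curve xt‖))) ∧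
      ∀ p ∈ ball (0 : E n × L2 t r) (controlRadius (D.bound T ‖V.curve xt‖)), ∀ w : ℝ → E r,
        w =ᵐ[volume.restrict (Ioc 0 t)] p.2 →
        IsSolution D xt t p.1 w (S p) ∧ J D xt t w (S p) = f p ∧
        ∀ q, IsSolution D xt t p.1 w q → q = S p := by
  set δ := controlRadius (D.bound T ‖V.curve xt‖)
  obtain ⟨S, hSs, hS⟩ := exists_smooth_deviation (D := D) (xt := xt) hα ht htT
  have hsub : ∀ (ξ : E n) (z : Curve t n × L2 t m),
      z.1 = ctrlLin ht.le D.opA D.opG D.opF ((V.curve xt).restrict htT) (ξ, z.2)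
        + ctrlQuad ht.le D.opA D.opG ((V.curve xt).restrict htT) z.1 z.1 →
      (V.curve (toPair D xt ht htT ξ z).1 - (V.curve xt).restrict htT,
        (toPair D xt ht htT ξ z).2) = z := by
    intro ξ z hz
    rw [curve_toPair ht htT hxt hz, add_sub_cancel_left]
    rfl
  have hsol : ∀ p ∈ ball (0 : E n × L2 t r) δ, ∀ w : ℝ → E r,
      w =ᵐ[volume.restrict (Ioc 0 t)] p.2 →
      IsSolution D xt t p.1 w (toPair D xt ht htT p.1 (S p)) ∧
      J D xt t w (toPair D xt ht htT p.1 (S p)) =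
        quadCost (Curve.eval ⟨0, left_mem_Icc.2 ht.le⟩) (D.obs ht.le) D.α p.2 (S p) ∧
      ∀ q, IsSolution D xt t p.1 w q → q = toPair D xt ht htT p.1 (S p) := by
    intro p hp w hw
    obtain ⟨h1, h2⟩ := hS p hp
    have hJ : J D xt t w (toPair D xt ht htT p.1 (S p)) =
        quadCost (Curve.eval ⟨0, left_mem_Icc.2 ht.le⟩) (D.obs ht.le) D.α p.2 (S p) := by
      rw [J_eq_quadCost ht htT hxt hw, hsub _ _ h1]
    have hfeas := toPair_mem_feasible ht htT hxt h1
    refine ⟨⟨hfeas, fun q hq => ?_⟩, hJ, fun q hq => ?_⟩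
    · rw [hJ, J_eq_quadCost ht htT hxt hw]
      exact (h2 _ (ctrl_eq_of_mem_feasible ht htT hxt hq)).1
    · have hle := hq.2 _ hfeas
      rw [hJ, J_eq_quadCost ht htT hxt hw] at hle
      have he := (h2 _ (ctrl_eq_of_mem_feasible ht htT hxt hq.1)).2 hle
      rw [eq_toPair_of_mem_feasible ht htT hxt hq.1, he]
  have hcost : ContDiffOn ℝ ∞ (fun p : E n × L2 t r =>
      quadCost (Curve.eval ⟨0, left_mem_Icc.2 ht.le⟩) (D.obs ht.le) D.α p.2 (S p)) (ball 0 δ) :=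
    (contDiff_quadCost _ _ _).comp_contDiffOn (contDiff_snd.contDiffOn.prodMk hSs)
  have hpair : ContDiffOn ℝ ∞ (fun p : E n × L2 t r => (p.1, S p)) (ball 0 δ) :=
    contDiff_fst.contDiffOn.prodMk hSs
  have hsm : ContDiffOn ℝ ∞ (fun p : E n × L2 t r => toPair D xt ht htT p.1 (S p)) (ball 0 δ) := by
    have h := contDiff_toPair (D := D) (xt := xt) ht htT
    fun_prop
  exact ⟨fun p => toPair D xt ht htT p.1 (S p), fun p =>
    quadCost (Curve.eval ⟨0, left_mem_Icc.2 ht.le⟩) (D.obs ht.le) D.α p.2 (S p), hsm, hcost, hsol⟩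

end Main

end MinEnergy

end

theorem mainTheorem9 (n m r : ℕ) (D : MinEnergy.Data n m r) (hα : 0 < D.α)
    (T : ℝ) (hT : 0 < T) (xt : MinEnergy.V T n) (hxt : MinEnergy.IsNominal D T xt) :
    ∃ δ : ℝ, 0 < δ ∧ ∀ t ∈ Ioc (0 : ℝ) T,
      -- the value function is smooth on the ball of `ℝ^n × L²(0,t;ℝ^r)`
      ContDiffOn ℝ ∞
        (fun p : MinEnergy.E n × MinEnergy.L2 t r => MinEnergy.value D xt t p.1 p.2)
        (ball 0 δ) ∧
      -- the same for measurements given on the whole interval `(0,T)`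
      ContDiffOn ℝ ∞
        (fun p : MinEnergy.E n × MinEnergy.L2 T r => MinEnergy.value D xt t p.1 p.2)
        (ball 0 δ) ∧
      -- unique solvability, and smooth dependence of the solution on the data
      ∃ S : MinEnergy.E n × MinEnergy.L2 t r → MinEnergy.V t n × MinEnergy.L2 t m,
        ContDiffOn ℝ ∞ S (ball 0 δ) ∧
        ∀ p ∈ ball (0 : MinEnergy.E n × MinEnergy.L2 t r) δ,
          MinEnergy.IsSolution D xt t p.1 p.2 (S p) ∧
          ∀ q, MinEnergy.IsSolution D xt t p.1 p.2 q → q = S p := by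
  open MinEnergy in
  refine ⟨controlRadius (D.bound T ‖V.curve xt‖), controlRadius_pos (bound_pos hα hT), ?_⟩
  rintro t ⟨ht, htT⟩
  obtain ⟨S, f, hSs, hfs, hS⟩ := exists_smooth_solution hα hxt ht htT
  refine ⟨?_, ?_, S, hSs, ?_⟩
  · refine hfs.congr fun p hp => ?_
    obtain ⟨h1, h2, -⟩ := hS p hp p.2 (Filter.EventuallyEq.refl _ _)
    rw [value_eq_of_isSolution h1, h2]
  · have hmaps := mapsTo_restrictL2_ball (n := n) (d := r) htT
      (controlRadius (D.bound T ‖V.curve xt‖))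
    refine (hfs.comp (contDiff_restrictL2 htT).contDiffOn hmaps).congr fun p hp => ?_
    obtain ⟨h1, h2, -⟩ := hS _ (hmaps hp) p.2 (coeFn_restrictL2 htT p.2).symm
    exact (value_eq_of_isSolution h1).trans h2
  · intro p hp
    obtain ⟨h1, -, h3⟩ := hS p hp p.2 (Filter.EventuallyEq.refl _ _)
    exact ⟨h1, h3⟩
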